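/- Let $n\ge 1$. For $\mu>0$ and compactly supported data $(u_0,u_1)\in H^1(\mathbf R^n)\times L^2(\mathbf R^n)$ consider the Cauchy problem $$u_{tt}-\Delta u+\frac{\mu}{1+t}u_t=0\quad\text{in }(0,\infty)\times\mathbf R^n,\qquad (u,u_t)(0,\cdot)=(u_0,u_1).$$ A solution is a function $u\in C([0,\infty);H^1(\mathbf R^n))\cap C^1([0,\infty);L^2(\mathbf R^n))$ that has these initial values and satisfies the equation weakly: for every $\varphi\in C_c^\infty(\mathbf R^n)$ and every $t>0$, $$\frac{d}{dt}\int_{\mathbf R^n}u_t\varphi\,dx=-\int_{\mathbf R^n}\nabla u\cdot\nabla\varphi\,dx-\frac{\mu}{1+t}\int_{\mathbf R^n}u_t\varphi\,dx .$$ For $\delta>0$ put $$\psi(t,x)=\frac{a|x|^2}{(1+t)^2},\quad a=\frac{\mu}{2(2+\delta)},\qquad I_0^2=\int_{\mathbf R^n}e^{2\psi(0,x)}\bigl(u_0^2+|\nabla u_0|^2+u_1^2\bigr)\,dx .$$ **Theorem 1.1.** For every $\varepsilon>0$ there are constants $\delta>0$ and $\mu_0>1$ (depending only on $n$ and $\varepsilon$)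 such that for every $\mu\ge\mu_0$ there is a constant $C=C_{\mu,\varepsilon}>0$ (depending only on $n$, $\mu$, $\varepsilon$) with the following property. For all compactly supported data $(u_0,u_1)\in H^1(\mathbf R^n)\times L^2(\mathbf R^n)$, the solution $u$ satisfies, for all $t\ge 0$, $$\int_{\mathbf R^n}e^{2\psi}u^2\,dx\le C\,I_0^2\,(1+t)^{-n+\varepsilon},\qquad \int_{\mathbf R^n}e^{2\psi}\bigl(u_t^2+|\nabla u|^2\bigr)\,dx\le C\,I_0^2\,(1+t)^{-n-2+\varepsilon},$$ where both integrands on the left are integrable. -/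

import Mathlib

open MeasureTheory Set
open scoped ContDiff

noncomputable section

namespace DampedWave

/-- Euclidean space `ℝⁿ`. -/
abbrev E (n : ℕ) := EuclideanSpace ℝ (Fin n)

/-- Real-valued `L²(ℝⁿ)`. -/
abbrev L2 (n : ℕ) := Lp ℝ 2 (volume : Measure (E n))

/-- Square integrable vector fields `L²(ℝⁿ; ℝⁿ)`. -/
abbrev L2Vec (n : ℕ) := Lp (E n) 2 (volume : Measure (E n))

/-- `φ ∈ C_c^∞(ℝⁿ)`. -/
def IsTestFunction {n : ℕ} (φ : E n → ℝ) : Prop :=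
  ContDiff ℝ ∞ φ ∧ HasCompactSupport φ

/-- `G` is the weak (distributional) gradient of `f`: `∫ f ∂_w φ = - ∫ (G · w) φ` for all test
functions `φ` and all directions `w`. -/
def HasWeakGradient {n : ℕ} (f : E n → ℝ) (G : E n → E n) : Prop :=
  ∀ φ : E n → ℝ, IsTestFunction φ → ∀ w : E n,
    ∫ x, f x * fderiv ℝ φ x w = - ∫ x, inner ℝ (G x) w * φ x

theorem IsTestFunction.memLp {n : ℕ} {φ : E n → ℝ} (h : IsTestFunction φ) :
    MemLp φ 2 (volume : Measure (E n)) :=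
  h.1.continuous.memLp_of_hasCompactSupport h.2

theorem IsTestFunction.memLp_fderiv {n : ℕ} {φ : E n → ℝ} (h : IsTestFunction φ) (w : E n) :
    MemLp (fun x => fderiv ℝ φ x w) 2 (volume : Measure (E n)) := by
  apply Continuous.memLp_of_hasCompactSupport
  · exact (h.1.continuous_fderiv (by simp)).clm_apply continuous_const
  · exact h.2.fderiv_apply (𝕜 := ℝ) w

theorem integrable_mul_fderiv {n : ℕ} (f : L2 n) {φ : E n → ℝ} (h : IsTestFunction φ) (w : E n) :
    Integrable (fun x => f x * fderiv ℝ φ x w) (volume : Measure (E n)) :=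
  (Lp.memLp f).integrable_mul (h.memLp_fderiv w)

theorem integrable_inner_mul {n : ℕ} (G : L2Vec n) {φ : E n → ℝ} (h : IsTestFunction φ)
    (w : E n) : Integrable (fun x => inner ℝ (G x) w * φ x) (volume : Measure (E n)) :=
  ((Lp.memLp G).inner_const w).integrable_mul h.memLp

/-- The space underlying `H¹(ℝⁿ)`: the pairs `(f, ∇f) ∈ L² × L²`, where `∇f` is
the weak gradient of `f`. -/
def H1Submodule (n : ℕ) : Submodule ℝ (WithLp 2 (L2 n × L2Vec n)) where
  carrier := {p | HasWeakGradient (p.fst : E n → ℝ) (p.snd : E n → E n)}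
  zero_mem' := by
    intro φ _ w
    simp
  add_mem' := by
    intro p q hp hq φ hφ w
    have e1 : (∫ x, ((p + q).fst : E n → ℝ) x * fderiv ℝ φ x w)
        = ∫ x, (p.fst x * fderiv ℝ φ x w + q.fst x * fderiv ℝ φ x w) := by
      apply integral_congr_ae
      filter_upwards [Lp.coeFn_add p.fst q.fst] with x hx
      rw [WithLp.add_fst, hx, Pi.add_apply, add_mul]
    have e2 : (∫ x, inner ℝ (((p + q).snd : E n → E n) x) w * φ x)
        = ∫ x, (inner ℝ (p.snd x) w * φ x + inner ℝ (q.snd x) w * φ x) := by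
      apply integral_congr_ae
      filter_upwards [Lp.coeFn_add p.snd q.snd] with x hx
      rw [WithLp.add_snd, hx, Pi.add_apply, inner_add_left, add_mul]
    rw [e1, e2, integral_add (integrable_mul_fderiv _ hφ w) (integrable_mul_fderiv _ hφ w),
      integral_add (integrable_inner_mul _ hφ w) (integrable_inner_mul _ hφ w),
      hp φ hφ w, hq φ hφ w, neg_add]
  smul_mem' := by
    intro c p hp φ hφ w
    have e1 : (∫ x, ((c • p).fst : E n → ℝ) x * fderiv ℝ φ x w)
        = ∫ x, c * (p.fst x * fderiv ℝ φ x w) := by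
      apply integral_congr_ae
      filter_upwards [Lp.coeFn_smul c p.fst] with x hx
      rw [WithLp.smul_fst, hx, Pi.smul_apply, smul_eq_mul, mul_assoc]
    have e2 : (∫ x, inner ℝ (((c • p).snd : E n → E n) x) w * φ x)
        = ∫ x, c * (inner ℝ (p.snd x) w * φ x) := by
      apply integral_congr_ae
      filter_upwards [Lp.coeFn_smul c p.snd] with x hx
      rw [WithLp.smul_snd, hx, Pi.smul_apply, real_inner_smul_left, mul_assoc]
    rw [e1, e2, integral_const_mul, integral_const_mul, hp φ hφ w, mul_neg]

/-- The Sobolev space `H¹(ℝⁿ)`, with its usual norm `‖f‖² = ‖f‖²_{L²} + ‖∇f‖²_{L²}`. -/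
abbrev H1 (n : ℕ) : Type := H1Submodule n

/-- The underlying `L²` function of an element of `H¹`. -/
def H1.fn {n : ℕ} (f : H1 n) : L2 n := f.1.fst

/-- The weak gradient of an element of `H¹`. -/
def H1.grad {n : ℕ} (f : H1 n) : L2Vec n := f.1.snd

/-- `f` vanishes almost everywhere outside some ball, i.e. `f` has compact support. -/
def CompactlySupported {n : ℕ} (f : L2 n) : Prop :=
  ∃ R : ℝ, ∀ᵐ x : E n, R < ‖x‖ → f x = 0

/-- `u ∈ C([0,∞); H¹(ℝⁿ)) ∩ C¹([0,∞); L²(ℝⁿ))`, with time derivative `ut = u_t`, is a (weak)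
solution of the Cauchy problem
`u_tt - Δu + μ/(1+t) u_t = 0` in `(0,∞) × ℝⁿ`, `(u, u_t)(0) = (u₀, u₁)`.
Only the values of `u` and `ut` at times `t ≥ 0` matter. -/
structure IsSolution {n : ℕ} (μ : ℝ) (u₀ : H1 n) (u₁ : L2 n) (u : ℝ → H1 n) (ut : ℝ → L2 n) :
    Prop where
  continuousOn : ContinuousOn u (Ici 0)
  hasDerivWithinAt : ∀ t ∈ Ici (0 : ℝ),
    HasDerivWithinAt (fun s => (u s).fn) (ut t) (Ici 0) t
  continuousOn_deriv : ContinuousOn ut (Ici 0)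
  initial : u 0 = u₀
  initial_deriv : ut 0 = u₁
  /-- The equation, tested against `φ ∈ C_c^∞(ℝⁿ)`:
  `d/dt ∫ u_t φ + ∫ ∇u · ∇φ + μ/(1+t) ∫ u_t φ = 0`. -/
  equation : ∀ φ : E n → ℝ, IsTestFunction φ → ∀ t : ℝ, 0 < t →
    HasDerivAt (fun s => ∫ x, ut s x * φ x)
      (- (∫ x, inner ℝ ((u t).grad x) (gradient φ x)) - μ / (1 + t) * ∫ x, ut t x * φ x) t

/-- The weight exponent `ψ(t,x) = a |x|² / (1+t)²` with `a = μ / (2 (2 + δ))`. -/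
def psi {n : ℕ} (μ δ t : ℝ) (x : E n) : ℝ :=
  μ / (2 * (2 + δ)) * ‖x‖ ^ 2 / (1 + t) ^ 2

/-- `I₀² = ∫ e^{2ψ(0,x)} (u₀² + |∇u₀|² + u₁²) dx`. -/
def initialEnergy {n : ℕ} (μ δ : ℝ) (u₀ : H1 n) (u₁ : L2 n) : ℝ :=
  ∫ x, Real.exp (2 * psi μ δ 0 x) * (u₀.fn x ^ 2 + ‖u₀.grad x‖ ^ 2 + u₁ x ^ 2)

end DampedWave

end

/-!
Weighted energy method. Write `s = 1 + t`, `b = μ / s` and `ψ = a |x|² / s²`. The weight is chosen so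
that `b (-ψ_t) = (2 + δ) |∇ψ|²` and `Δψ = n b / ((2 + δ) s)`. Multiplying the equation by
`e^{2ψ} u_t` and by `e^{2ψ} u` and adding, with `u ∇ψ · ∇u` partly integrated by parts so as to bring
in `Δψ`, shows that

  `s ^ k ∫ e^{2ψ} (u u_t + (b / 2) u² + (K s / 2) (u_t² + |∇u|²))`,  `k = n + 1 - ε`,

is nonincreasing in time for small `δ` and `K` and large `μ`: the term with `Δψ` and the derivative of
`b` give `u²` the decay exponent `2 n / (2 + δ) + 1`, which exceeds `k` if `n δ ≤ ε`, and the mixed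
terms are absorbed since `s b = μ` is large. This is the pointwise inequality `energy_density_le`.
The functional is bounded below by `∫ e^{2ψ} (b u² + K s (u_t² + |∇u|²)) / 4`
(`AdmissibleParameters.le_density`), which contains both claims.

For weak solutions the argument is applied to mollifications in `x`. The coefficients depend on `t`
only, so a mollified solution is a classical solution
(`IsSolution.isClassicalSolution_mollify`). Finite speed of propagation
(`IsClassicalSolution.eq_zero_of_lt_norm`, an energy estimate with a weight that lives in a backward
light cone) keeps it compactly supported in space, so the unbounded weight `e^{2ψ}` causes no trouble
in `IsClassicalSolution.weighted_energy_bound`. Both energy estimates are instances of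
`integral_le_of_deriv_le_divergence`. By Jensen's inequality the weighted initial energy of a
sufficiently fine mollification is at most twice the original one
(`integral_exp_mul_mollify_sq_le`), and Fatou's lemma gives integrability and the bound for the weak
solution in the limit.
-/

noncomputable section

namespace DampedWave

/-! ### Integrals of functions evolving by a flux -/

theorem integral_eq_zero_of_hasLineDerivAt {n : ℕ} {g g' : E n → ℝ} {v : E n} {K : Set (E n)}
    (hK : IsCompact K) (hg : Continuous g) (hg' : Continuous g') (hgK : ∀ x ∉ K, g x = 0)
    (hg'K : ∀ x ∉ K, g' x = 0) (h : ∀ x, HasLineDerivAt ℝ g (g' x) x v) :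
    ∫ x, g' x = 0 := by
  have i1 : Integrable g := hg.integrable_of_hasCompactSupport (HasCompactSupport.intro hK hgK)
  have i2 : Integrable g' := hg'.integrable_of_hasCompactSupport (HasCompactSupport.intro hK hg'K)
  have := integral_bilinear_hasLineDerivAt_right_eq_neg_left_of_integrable (μ := volume)
    (f := fun _ : E n => (1 : ℝ)) (f' := fun _ => 0) (g := g) (g' := g') (v := v)
    (B := ContinuousLinearMap.mul ℝ ℝ) (by simp) (by simpa using i2) (by simpa using i1)
    (fun x _ => hasDerivAt_const 0 (1 : ℝ)) (fun x _ => h x)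
  simpa using this

theorem eq_zero_of_hasLineDerivAt {n : ℕ} {g : E n → ℝ} {g' : ℝ} {x v : E n} {U : Set (E n)}
    (hU : IsOpen U) (hx : x ∈ U) (hg : ∀ y ∈ U, g y = 0) (h : HasLineDerivAt ℝ g g' x v) :
    g' = 0 := by
  have e : (fun r : ℝ => g (x + r • v)) =ᶠ[nhds 0] fun _ => (0 : ℝ) := by
    have : Continuous fun r : ℝ => x + r • v := by fun_prop
    filter_upwards [this.continuousAt.preimage_mem_nhds (hU.mem_nhds (by simpa using hx))]
      with r hr using hg _ hr
  exact (HasDerivAt.congr_of_eventuallyEq h e.symm).unique (hasDerivAt_const 0 (0 : ℝ))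

/-- If a density `P` is supported in a fixed compact set and its time derivative is at most the
divergence of a compactly supported flux `X`, then its integral does not increase. -/
theorem integral_le_of_deriv_le_divergence {n : ℕ} {T : ℝ} (hT : 0 ≤ T) {K : Set (E n)}
    (hK : IsCompact K) {P P' : ℝ → E n → ℝ} {X X' : Fin n → ℝ → E n → ℝ}
    (hP : ContinuousOn (Function.uncurry P) (Icc 0 T ×ˢ univ))
    (hP' : ContinuousOn (Function.uncurry P') (Icc 0 T ×ˢ univ))
    (hPd : ∀ t ∈ Ioo 0 T, ∀ x, HasDerivAt (fun s => P s x) (P' t x) t)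
    (hPK : ∀ t ∈ Icc 0 T, ∀ x ∉ K, P t x = 0)
    (hX : ∀ i, ∀ t ∈ Ioo 0 T, Continuous (X i t))
    (hX' : ∀ i, ∀ t ∈ Ioo 0 T, Continuous (X' i t))
    (hXd : ∀ i, ∀ t ∈ Ioo 0 T, ∀ x,
      HasLineDerivAt ℝ (X i t) (X' i t x) x (EuclideanSpace.single i 1))
    (hXK : ∀ i, ∀ t ∈ Ioo 0 T, ∀ x ∉ K, X i t x = 0)
    (hle : ∀ t ∈ Ioo 0 T, ∀ x, P' t x ≤ ∑ i, X' i t x) :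
    ∫ x, P T x ≤ ∫ x, P 0 x := by
  have slice : ∀ {Q : ℝ → E n → ℝ}, ContinuousOn (Function.uncurry Q) (Icc 0 T ×ˢ univ) →
      ∀ t ∈ Icc 0 T, Continuous (Q t) := by
    intro Q hQ t ht
    have : Continuous fun x : E n => (t, x) := by fun_prop
    exact hQ.comp_continuous this (fun x => ⟨ht, mem_univ _⟩)
  have hP'K : ∀ t ∈ Ioo 0 T, ∀ x ∉ K, P' t x = 0 := by
    intro t ht x hx
    have e : (fun s => P s x) =ᶠ[nhds t] fun _ => (0 : ℝ) := by
      filter_upwards [isOpen_Ioo.mem_nhds ht] with s hs using hPK s (Ioo_subset_Icc_self hs) x hx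
    exact (HasDerivAt.congr_of_eventuallyEq (hPd t ht x) e.symm).unique (hasDerivAt_const t (0 : ℝ))
  have hX'K : ∀ i, ∀ t ∈ Ioo 0 T, ∀ x ∉ K, X' i t x = 0 := fun i t ht x hx =>
    eq_zero_of_hasLineDerivAt hK.isClosed.isOpen_compl hx (fun y hy => hXK i t ht y hy)
      (hXd i t ht x)
  have hder : ∀ t ∈ Ioo 0 T, HasDerivAt (fun s => ∫ x, P s x) (∫ x, P' t x) t := by
    intro t ht
    obtain ⟨C, hC⟩ := (isCompact_Icc.prod hK).exists_bound_of_continuousOn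
      (hP'.mono (prod_mono (subset_refl (Icc 0 T)) (subset_univ K)))
    refine (hasDerivAt_integral_of_dominated_loc_of_deriv_le (s := Ioo 0 T)
      (bound := K.indicator fun _ => C) (isOpen_Ioo.mem_nhds ht) ?_ ?_ ?_ ?_ ?_ ?_).2
    · filter_upwards [isOpen_Ioo.mem_nhds ht] with s hs
      exact (slice hP s (Ioo_subset_Icc_self hs)).aestronglyMeasurable
    · exact (slice hP t (Ioo_subset_Icc_self ht)).integrable_of_hasCompactSupport
        (HasCompactSupport.intro hK (hPK t (Ioo_subset_Icc_self ht)))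
    · exact (slice hP' t (Ioo_subset_Icc_self ht)).aestronglyMeasurable
    · refine Filter.Eventually.of_forall fun x s hs => ?_
      by_cases hx : x ∈ K
      · rw [indicator_of_mem hx]
        exact hC (s, x) ⟨Ioo_subset_Icc_self hs, hx⟩
      · rw [indicator_of_notMem hx, hP'K s hs x hx, norm_zero]
    · exact (integrable_indicator_iff hK.measurableSet).2
        (integrableOn_const (hK.measure_lt_top.ne))
    · exact Filter.Eventually.of_forall fun x s hs => hPd s hs x
  have hanti : AntitoneOn (fun s => ∫ x, P s x) (Icc 0 T) := by
    apply antitoneOn_of_deriv_nonpos (convex_Icc 0 T)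
    · exact continuousOn_integral_of_compact_support hK hP (fun t x ht hx => hPK t ht x hx)
    · rw [interior_Icc]
      exact fun t ht => (hder t ht).differentiableAt.differentiableWithinAt
    · rw [interior_Icc]
      intro t ht
      rw [(hder t ht).deriv]
      have iX : ∀ i, Integrable (X' i t) := fun i =>
        (hX' i t ht).integrable_of_hasCompactSupport (HasCompactSupport.intro hK (hX'K i t ht))
      have iP : Integrable (P' t) :=
        (slice hP' t (Ioo_subset_Icc_self ht)).integrable_of_hasCompactSupport
          (HasCompactSupport.intro hK (hP'K t ht))
      calc ∫ x, P' t x ≤ ∫ x, ∑ i, X' i t x :=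
            integral_mono iP (integrable_finsetSum _ fun i _ => iX i) (hle t ht)
        _ = ∑ i, ∫ x, X' i t x := integral_finsetSum _ fun i _ => iX i
        _ = 0 := Finset.sum_eq_zero fun i _ => integral_eq_zero_of_hasLineDerivAt hK (hX i t ht)
            (hX' i t ht) (hXK i t ht) (hX'K i t ht) (hXd i t ht)
  exact hanti (left_mem_Icc.2 hT) (right_mem_Icc.2 hT) hT

/-! ### Classical solutions and finite speed of propagation -/

/-- A classical solution `v` of the damped wave equation on `[0,∞) × ℝⁿ`, given together with the
derivatives which occur in energy identities: `w = v_t`, `g i = ∂ᵢ v`, `h i = ∂ᵢ² v`,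
`z i = ∂ᵢ v_t`. -/
structure IsClassicalSolution {n : ℕ} (μ : ℝ) (v w : ℝ → E n → ℝ) (g h z : Fin n → ℝ → E n → ℝ) :
    Prop where
  cont : ContinuousOn (Function.uncurry v) (Ici 0 ×ˢ univ)
  cont_w : ContinuousOn (Function.uncurry w) (Ici 0 ×ˢ univ)
  cont_g : ∀ i, ContinuousOn (Function.uncurry (g i)) (Ici 0 ×ˢ univ)
  cont_h : ∀ i, ContinuousOn (Function.uncurry (h i)) (Ici 0 ×ˢ univ)
  cont_z : ∀ i, ContinuousOn (Function.uncurry (z i)) (Ici 0 ×ˢ univ)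
  time : ∀ t, 0 < t → ∀ x, HasDerivAt (fun s => v s x) (w t x) t
  time_g : ∀ i t, 0 < t → ∀ x, HasDerivAt (fun s => g i s x) (z i t x) t
  equation : ∀ t, 0 < t → ∀ x,
    HasDerivAt (fun s => w s x) (∑ i, h i t x - μ / (1 + t) * w t x) t
  space : ∀ i t, 0 ≤ t → ∀ x, HasLineDerivAt ℝ (v t) (g i t x) x (EuclideanSpace.single i 1)
  space_w : ∀ i t, 0 ≤ t → ∀ x, HasLineDerivAt ℝ (w t) (z i t x) x (EuclideanSpace.single i 1)
  space_g : ∀ i t, 0 ≤ t → ∀ x, HasLineDerivAt ℝ (g i t) (h i t x) x (EuclideanSpace.single i 1)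

theorem hasDerivAt_norm_sub_sq_line {n : ℕ} (x x₀ : E n) (i : Fin n) :
    HasDerivAt (fun r : ℝ => ‖x + r • EuclideanSpace.single i 1 - x₀‖ ^ 2) (2 * (x - x₀) i) 0 := by
  have e : (fun r : ℝ => ‖x + r • EuclideanSpace.single i 1 - x₀‖ ^ 2)
      = fun r : ℝ => ‖x - x₀‖ ^ 2 + 2 * (x - x₀) i * r + r ^ 2 := by
    funext r
    rw [add_sub_right_comm, norm_add_sq_real, inner_smul_right, norm_smul, mul_pow,
      PiLp.norm_single, EuclideanSpace.inner_single_right]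
    simp
    ring
  rw [e]
  have := (((hasDerivAt_id (0 : ℝ)).const_mul (2 * (x - x₀) i)).const_add (‖x - x₀‖ ^ 2)).add
    ((hasDerivAt_id (0 : ℝ)).pow 2)
  exact this.congr_deriv (by simp)

theorem continuous_slice {n : ℕ} {Q : ℝ → E n → ℝ}
    (hQ : ContinuousOn (Function.uncurry Q) (Ici 0 ×ˢ univ)) {t : ℝ} (ht : 0 ≤ t) :
    Continuous (Q t) := by
  have : Continuous fun x : E n => (t, x) := by fun_prop
  exact hQ.comp_continuous this (fun x => ⟨ht, mem_univ _⟩)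

/-- The inequality behind finite speed of propagation: inside the light cone `|y| ≤ c`, the
change of the weight dominates the energy flux. -/
theorem two_mul_mul_sum_le {n : ℕ} {c w : ℝ} (hc : 0 ≤ c) (y g : Fin n → ℝ)
    (hy : ∑ i, y i ^ 2 ≤ c ^ 2) :
    2 * w * ∑ i, y i * g i ≤ c * (w ^ 2 + ∑ i, g i ^ 2) := by
  have h1 := Finset.sum_mul_sq_le_sq_mul_sq Finset.univ y g
  have hG : 0 ≤ ∑ i, g i ^ 2 := Finset.sum_nonneg fun i _ => sq_nonneg _
  set G := ∑ i, g i ^ 2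
  set S := ∑ i, y i * g i
  have h2 : S ^ 2 ≤ c ^ 2 * G := h1.trans (by gcongr)
  have h3 : |S| ≤ c * Real.sqrt G := by
    apply abs_le_of_sq_le_sq _ (by positivity)
    rw [mul_pow, Real.sq_sqrt hG]
    exact h2
  have h4 : 2 * w * S ≤ 2 * |w| * (c * Real.sqrt G) := by
    calc 2 * w * S ≤ |2 * w * S| := le_abs_self _
      _ = 2 * |w| * |S| := by rw [abs_mul, abs_mul, abs_two]
      _ ≤ _ := by gcongr
  nlinarith [mul_nonneg hc (sq_nonneg (|w| - Real.sqrt G)), Real.sq_sqrt hG, sq_abs w]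

namespace IsClassicalSolution

variable {n : ℕ} {μ : ℝ} {v w : ℝ → E n → ℝ} {g h z : Fin n → ℝ → E n → ℝ}

/-- Domain of dependence: if the data vanish on a ball of radius larger than `T` around `x₀`,
then `v_t` and `∇v` vanish at `(T, x₀)`. -/
theorem deriv_eq_zero_of_initial (hs : IsClassicalSolution μ v w g h z) (hμ : 0 ≤ μ)
    {T r : ℝ} (hT : 0 ≤ T) (hr : T < r) (x₀ : E n)
    (h0 : ∀ x ∈ Metric.closedBall x₀ r, w 0 x = 0 ∧ ∀ i, g i 0 x = 0) :
    w T x₀ = 0 ∧ ∀ i, g i T x₀ = 0 := by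
  set χ := expNegInvGlue
  have χs : ContDiff ℝ 1 χ := expNegInvGlue.contDiff (n := 1)
  have χc : Continuous χ := χs.continuous
  have χd : ∀ r, HasDerivAt χ (deriv χ r) r := fun r =>
    (χs.differentiable (by simp) r).hasDerivAt
  have χ'c : Continuous (deriv χ) := χs.continuous_deriv le_rfl
  have χ0 : ∀ r ≤ 0, χ r = 0 := fun r hr => expNegInvGlue.zero_of_nonpos hr
  have χnn : ∀ r, 0 ≤ χ r := expNegInvGlue.nonneg
  have χ'nn : ∀ r, 0 ≤ deriv χ r := fun r => expNegInvGlue.monotone.deriv_nonneg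
  have χ'0 : ∀ r < 0, deriv χ r = 0 := fun r hr => by
    have e : χ =ᶠ[nhds r] fun _ => (0 : ℝ) := by
      filter_upwards [isOpen_Iio.mem_nhds hr] with y hy using χ0 y hy.le
    exact ((χd r).congr_of_eventuallyEq e.symm).unique (hasDerivAt_const r (0 : ℝ))
  -- the weight is positive exactly inside the backward light cone with apex `(r, x₀)`
  set q : ℝ → E n → ℝ := fun t x => (r - t) ^ 2 - ‖x - x₀‖ ^ 2 with hq
  have hqK : ∀ t ∈ Icc 0 T, ∀ x ∉ Metric.closedBall x₀ r, q t x < 0 := by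
    intro t ht x hx
    rw [Metric.mem_closedBall, dist_eq_norm, not_le] at hx
    have : (r - t) ^ 2 < ‖x - x₀‖ ^ 2 := by
      apply pow_lt_pow_left₀ _ _ two_ne_zero <;> linarith [ht.1, ht.2]
    simp only [hq]; linarith
  have sub : Icc 0 T ×ˢ (univ : Set (E n)) ⊆ Ici 0 ×ˢ univ :=
    prod_mono Icc_subset_Ici_self subset_rfl
  have cw : ContinuousOn (fun p : ℝ × E n => w p.1 p.2) (Icc 0 T ×ˢ univ) := hs.cont_w.mono sub
  have cg : ∀ i, ContinuousOn (fun p : ℝ × E n => g i p.1 p.2) (Icc 0 T ×ˢ univ) :=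
    fun i => (hs.cont_g i).mono sub
  have ch : ∀ i, ContinuousOn (fun p : ℝ × E n => h i p.1 p.2) (Icc 0 T ×ˢ univ) :=
    fun i => (hs.cont_h i).mono sub
  have cz : ∀ i, ContinuousOn (fun p : ℝ × E n => z i p.1 p.2) (Icc 0 T ×ˢ univ) :=
    fun i => (hs.cont_z i).mono sub
  have cq : Continuous (fun p : ℝ × E n => q p.1 p.2) := by
    simp only [hq]; fun_prop
  have cb : ContinuousOn (fun p : ℝ × E n => μ / (1 + p.1)) (Icc 0 T ×ˢ univ) := by
    apply ContinuousOn.div continuousOn_const (by fun_prop)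
    rintro ⟨t, x⟩ ⟨ht, -⟩
    have := ht.1
    simp only; linarith
  have cχ : Continuous fun p : ℝ × E n => χ (q p.1 p.2) := χc.comp cq
  have cχ' : Continuous fun p : ℝ × E n => deriv χ (q p.1 p.2) := χ'c.comp cq
  have main := integral_le_of_deriv_le_divergence hT (isCompact_closedBall x₀ r)
    (P := fun t x => χ (q t x) * (w t x ^ 2 + ∑ i, g i t x ^ 2))
    (P' := fun t x => deriv χ (q t x) * (-(2 * (r - t))) * (w t x ^ 2 + ∑ i, g i t x ^ 2)
      + χ (q t x) * (2 * w t x * (∑ i, h i t x - μ / (1 + t) * w t x)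
        + ∑ i, 2 * g i t x * z i t x))
    (X := fun i t x => 2 * χ (q t x) * (w t x * g i t x))
    (X' := fun i t x => 2 * (deriv χ (q t x) * (-(2 * (x - x₀) i))) * (w t x * g i t x)
      + 2 * χ (q t x) * (z i t x * g i t x + w t x * h i t x))
    (by simp only [Function.uncurry_def]; fun_prop)
    (by simp only [Function.uncurry_def]; fun_prop)
    ?_ ?_ ?_ ?_ ?_ ?_ ?_
  · have e0 : ∀ x, χ (q 0 x) * (w 0 x ^ 2 + ∑ i, g i 0 x ^ 2) = 0 := by
      intro x
      by_cases hx : x ∈ Metric.closedBall x₀ r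
      · obtain ⟨h1, h2⟩ := h0 x hx
        simp [h1, h2]
      · rw [χ0 _ (hqK 0 ⟨le_rfl, hT⟩ x hx).le, zero_mul]
    have nn : ∀ x, 0 ≤ χ (q T x) * (w T x ^ 2 + ∑ i, g i T x ^ 2) := fun x =>
      mul_nonneg (χnn _) (add_nonneg (sq_nonneg _) (Finset.sum_nonneg fun i _ => sq_nonneg _))
    have cont : Continuous fun x => χ (q T x) * (w T x ^ 2 + ∑ i, g i T x ^ 2) := by
      have c1 := continuous_slice hs.cont_w hT
      have c2 := fun i => continuous_slice (hs.cont_g i) hT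
      have c3 : Continuous fun x => χ (q T x) := by simp only [hq]; fun_prop
      fun_prop
    have int : Integrable fun x => χ (q T x) * (w T x ^ 2 + ∑ i, g i T x ^ 2) :=
      cont.integrable_of_hasCompactSupport (HasCompactSupport.intro (isCompact_closedBall x₀ r)
        fun x hx => by rw [χ0 _ (hqK T ⟨hT, le_rfl⟩ x hx).le, zero_mul])
    replace main := main.trans (integral_eq_zero_of_ae (Filter.Eventually.of_forall e0)).le
    have z0 := (integral_eq_zero_iff_of_nonneg nn int).1 (le_antisymm main (integral_nonneg nn))
    have z1 : χ (q T x₀) * (w T x₀ ^ 2 + ∑ i, g i T x₀ ^ 2) = 0 :=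
      congrFun ((Continuous.ae_eq_iff_eq volume cont continuous_const).1 z0) x₀
    have qpos : 0 < χ (q T x₀) := by
      apply expNegInvGlue.pos_of_pos
      simp only [hq, sub_self, norm_zero]
      nlinarith
    have z2 := (mul_eq_zero.1 z1).resolve_left qpos.ne'
    have s0 : 0 ≤ ∑ i, g i T x₀ ^ 2 := Finset.sum_nonneg fun i _ => sq_nonneg _
    refine ⟨pow_eq_zero_iff two_ne_zero |>.1 (by nlinarith [sq_nonneg (w T x₀)]), fun i => ?_⟩
    have s1 : ∑ i, g i T x₀ ^ 2 = 0 := by nlinarith [sq_nonneg (w T x₀)]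
    exact pow_eq_zero_iff two_ne_zero |>.1
      ((Finset.sum_eq_zero_iff_of_nonneg fun i _ => sq_nonneg _).1 s1 i (Finset.mem_univ i))
  · intro t ht x
    have dq : HasDerivAt (fun s => q s x) (-(2 * (r - t))) t := by
      have := ((((hasDerivAt_id t).const_sub r).pow 2).sub_const (‖x - x₀‖ ^ 2))
      exact this.congr_deriv (by simp)
    have d1 := (χd (q t x)).comp t dq
    have d2 := ((hs.equation t ht.1 x).pow 2).add
      (HasDerivAt.fun_sum fun i (_ : i ∈ Finset.univ) => (hs.time_g i t ht.1 x).pow 2)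
    refine (d1.mul d2).congr_deriv ?_
    simp
  · intro t ht x hx
    simp only [χ0 _ (hqK t ht x hx).le, zero_mul]
  · intro i t ht
    have c1 := continuous_slice hs.cont_w ht.1.le
    have c2 := continuous_slice (hs.cont_g i) ht.1.le
    have c3 : Continuous fun x => χ (q t x) := by simp only [hq]; fun_prop
    fun_prop
  · intro i t ht
    have c1 := continuous_slice hs.cont_w ht.1.le
    have c2 := continuous_slice (hs.cont_g i) ht.1.le
    have c3 : Continuous fun x => χ (q t x) := by simp only [hq]; fun_prop
    have c4 : Continuous fun x => deriv χ (q t x) := by simp only [hq]; fun_prop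
    have c5 := continuous_slice (hs.cont_h i) ht.1.le
    have c6 := continuous_slice (hs.cont_z i) ht.1.le
    fun_prop
  · intro i t ht x
    have dq : HasDerivAt (fun r' : ℝ => q t (x + r' • EuclideanSpace.single i 1))
        (-(2 * (x - x₀) i)) 0 := (hasDerivAt_norm_sub_sq_line x x₀ i).const_sub _
    have d1 := ((χd _).comp 0 dq).const_mul 2
    have d2 := HasDerivAt.mul (hs.space_w i t ht.1.le x) (hs.space_g i t ht.1.le x)
    have d3 := d1.mul d2
    simp only [zero_smul, add_zero, Function.comp_def, Pi.mul_apply] at d3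
    exact d3
  · intro i t ht x hx
    simp only [χ0 _ (hqK t (Ioo_subset_Icc_self ht) x hx).le, mul_zero, zero_mul]
  · intro t ht x
    have e : ∑ i, (2 * (deriv χ (q t x) * (-(2 * (x - x₀) i))) * (w t x * g i t x)
        + 2 * χ (q t x) * (z i t x * g i t x + w t x * h i t x))
        = deriv χ (q t x) * (-2 * (2 * w t x * ∑ i, (x - x₀) i * g i t x))
          + χ (q t x) * (2 * w t x * ∑ i, h i t x + ∑ i, 2 * g i t x * z i t x) := by
      simp only [mul_add, Finset.sum_add_distrib, Finset.mul_sum, ← add_assoc]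
      rw [add_right_comm]
      congr 1
      · congr 1 <;> refine Finset.sum_congr rfl fun i _ => by ring
      · refine Finset.sum_congr rfl fun i _ => by ring
    rw [e]
    have hb : 0 ≤ χ (q t x) * (μ / (1 + t) * w t x ^ 2) := by
      have : 0 < 1 + t := by linarith [ht.1]
      have := χnn (q t x)
      positivity
    have hmain : deriv χ (q t x) * (-2 * ((r - t) * (w t x ^ 2 + ∑ i, g i t x ^ 2)
        - 2 * w t x * ∑ i, (x - x₀) i * g i t x)) ≤ 0 := by
      rcases lt_or_ge (q t x) 0 with hneg | hpos
      · rw [χ'0 _ hneg, zero_mul]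
      · apply mul_nonpos_of_nonneg_of_nonpos (χ'nn _)
        have := two_mul_mul_sum_le (c := r - t) (w := w t x) (by linarith [ht.2])
          (fun i => (x - x₀) i) (fun i => g i t x) (by
            rw [← EuclideanSpace.real_norm_sq_eq]
            simp only [hq] at hpos
            linarith)
        linarith
    nlinarith [hb, hmain]

/-- Finite speed of propagation. -/
theorem eq_zero_of_lt_norm (hs : IsClassicalSolution μ v w g h z) (hμ : 0 ≤ μ) {R : ℝ}
    (h0 : ∀ x, R < ‖x‖ → v 0 x = 0 ∧ w 0 x = 0 ∧ ∀ i, g i 0 x = 0) {t : ℝ} (ht : 0 ≤ t) {x : E n}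
    (hx : R + t < ‖x‖) : v t x = 0 ∧ w t x = 0 ∧ ∀ i, g i t x = 0 := by
  have key : ∀ s ∈ Icc 0 t, w s x = 0 ∧ ∀ i, g i s x = 0 := by
    intro s hst
    obtain ⟨r, hr1, hr2⟩ := exists_between (show t < ‖x‖ - R by linarith)
    refine hs.deriv_eq_zero_of_initial hμ hst.1 (r := r) (by linarith [hst.2]) x fun y hy => ?_
    refine (h0 y ?_).2
    rw [Metric.mem_closedBall, dist_eq_norm] at hy
    have := norm_sub_norm_le x y
    rw [norm_sub_rev] at this
    linarith
  refine ⟨?_, key t ⟨ht, le_rfl⟩⟩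
  have hc : ContinuousOn (fun s => v s x) (Icc 0 t) := by
    have : ContinuousOn (fun s : ℝ => (s, x)) (Icc 0 t) := by fun_prop
    exact hs.cont.comp this fun s hs' => ⟨hs'.1, mem_univ _⟩
  rcases ht.eq_or_lt with rfl | htpos
  · exact (h0 x (by linarith)).1
  · obtain ⟨c, hc1, hc2⟩ := exists_hasDerivAt_eq_slope (fun s => v s x) (fun s => w s x) htpos hc
      (fun s hs' => hs.time s hs'.1 x)
    rw [(key c (Ioo_subset_Icc_self hc1)).1, (h0 x (by linarith)).1, eq_comm,
      div_eq_zero_iff] at hc2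
    rcases hc2 with h | h <;> linarith

end IsClassicalSolution

/-! ### The weighted energy inequality -/

/-- The conditions on the parameters under which the weighted energy
`(1 + t) ^ k ∫ e^{2ψ} (u u_t + μ / (2 (1 + t)) u² + K (1 + t) / 2 (u_t² + |∇u|²))`
is nonincreasing in time and positive definite. The number `η` is half the loss in the decay
exponent. -/
structure AdmissibleParameters (n : ℕ) (μ δ K k η : ℝ) : Prop where
  μ_pos : 0 < μ
  δ_pos : 0 < δ
  K_pos : 0 < K
  η_pos : 0 < η
  decay : k / 2 + η / 2 ≤ n / (2 + δ) + 1 / 2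
  grad : K * (1 + k) / 2 ≤ δ / (8 + δ)
  cross : 2 * (2 + δ) ≤ K * δ * μ
  damping : 1 + K * (1 + k) / 2 + k ^ 2 / (2 * η * μ) ≤ K * μ * (1 - 1 / (2 + δ))
  definite : 4 ≤ K * μ

theorem add_two_mul_add_sq_mul_nonneg {G S Y : ℝ} (hY : 0 ≤ Y) (hG : 0 ≤ G) (h : S ^ 2 ≤ Y * G)
    (c : ℝ) : 0 ≤ G + 2 * c * S + c ^ 2 * Y := by
  rcases hY.eq_or_lt with rfl | hY
  · have : S = 0 := by
      rw [zero_mul] at h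
      exact pow_eq_zero_iff two_ne_zero |>.1 (le_antisymm h (sq_nonneg S))
    simpa [this] using hG
  · refine nonneg_of_mul_nonneg_right (a := Y) ?_ hY
    nlinarith [sq_nonneg (S + c * Y)]

/-- The pointwise inequality between the time derivative of the weighted energy density and the
divergence of its flux. Here `v, w, Y, G, S, H, Z` stand for
`u, u_t, |x|², |∇u|², x · ∇u, Δu, ∇u · ∇u_t` and `s = 1 + t`. -/
theorem energy_density_le {n : ℕ} {μ δ K k η : ℝ} (hp : AdmissibleParameters n μ δ K k η)
    {a s : ℝ} (ha : a = μ / (2 * (2 + δ))) (hs : 0 < s) (v w H Z : ℝ) {Y G S : ℝ} (hY : 0 ≤ Y)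
    (hG : 0 ≤ G) (hS : S ^ 2 ≤ Y * G) :
    (k / s - 4 * a * Y / s ^ 3) * (v * w + μ / (2 * s) * v ^ 2 + K * s / 2 * (w ^ 2 + G))
      + (w * w + v * (H - μ / s * w) - μ / (2 * s ^ 2) * v ^ 2 + μ / (2 * s) * (2 * v * w)
        + K / 2 * (w ^ 2 + G) + K * s / 2 * (2 * w * (H - μ / s * w) + 2 * Z)) ≤
    4 * a / s ^ 2 * (v * S) + 8 * a ^ 2 / s ^ 4 * Y * v ^ 2 + 4 * a / s ^ 2 * (K * s * w * S)
      + G + v * H + n * (2 * a / s ^ 2 * v ^ 2) + 4 * a / s ^ 2 * (v * S)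
      + K * s * (Z + w * H) := by
  obtain ⟨hμ, hδ, hK, hη, hdecay, hgrad, hcross, hdamp, -⟩ := hp
  have hapos : 0 < a := by rw [ha]; positivity
  have hμa : μ = 2 * (2 + δ) * a := by rw [ha]; field_simp
  have A1 : 0 ≤ 8 / (8 + δ) * (G + 2 * ((8 + δ) / 2 * (a * v / s ^ 2)) * S
      + ((8 + δ) / 2 * (a * v / s ^ 2)) ^ 2 * Y) :=
    mul_nonneg (by positivity) (add_two_mul_add_sq_mul_nonneg hY hG hS _)
  have A2 : 0 ≤ 2 * a * K * (Y * G / s ^ 2 + 2 * w * (S / s) + w ^ 2) := by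
    have h1 : S ^ 2 / s ^ 2 ≤ Y * G / s ^ 2 := by gcongr
    have h2 : 0 ≤ (S / s + w) ^ 2 := sq_nonneg _
    rw [add_sq, div_pow] at h2
    apply mul_nonneg (by positivity)
    linarith
  have A3 : 0 ≤ 2 * a * Y / s ^ 2 * (K * (w + v / (K * s)) ^ 2) := by positivity
  have A4 : 0 ≤ 1 / (2 * μ * η) * (μ * η * v / s - k * w) ^ 2 := by positivity
  have A5 : 0 ≤ (2 * δ * a ^ 2 - 2 * a / K) * (Y * v ^ 2 / s ^ 4) := by
    apply mul_nonneg _ (by positivity)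
    have : 1 ≤ K * δ * a := by
      rw [hμa] at hcross
      nlinarith
    have : 2 * a / K ≤ 2 * a * (δ * a) := by
      rw [div_eq_mul_one_div]
      gcongr
      rw [div_le_iff₀ hK]; linarith
    linarith
  have A6 : 0 ≤ (δ / (8 + δ) - K * (1 + k) / 2) * G := mul_nonneg (by linarith) hG
  have A7 : 0 ≤ (n / (2 + δ) + 1 / 2 - k / 2 - η / 2) * (μ / s ^ 2 * v ^ 2) :=
    mul_nonneg (by linarith) (by positivity)
  have A8 : 0 ≤ (K * μ * (1 - 1 / (2 + δ)) - 1 - K * (1 + k) / 2 - k ^ 2 / (2 * η * μ)) * w ^ 2 :=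
    mul_nonneg (by linarith) (sq_nonneg _)
  rw [← sub_nonneg]
  refine (add_nonneg (add_nonneg (add_nonneg (add_nonneg A1 A2) (add_nonneg A3 A4))
    (add_nonneg A5 A6)) (add_nonneg A7 A8)).trans_eq ?_
  subst hμa
  field_simp
  ring

/-- The weighted energy density controls all squares, as `K μ ≥ 4`. -/
theorem AdmissibleParameters.le_density {n : ℕ} {μ δ K k η : ℝ} (hp : AdmissibleParameters n μ δ K k η) {s : ℝ}
    (hs : 0 < s) (v w : ℝ) {G : ℝ} (hG : 0 ≤ G) :
    μ / (4 * s) * v ^ 2 + K * s / 4 * (w ^ 2 + G)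
      ≤ v * w + μ / (2 * s) * v ^ 2 + K * s / 2 * (w ^ 2 + G) := by
  have hμ := hp.μ_pos
  have hK := hp.K_pos
  have h1 : 0 ≤ μ / (4 * s) * (v + 2 * s / μ * w) ^ 2 := by positivity
  have h2 : 0 ≤ (K * μ - 4) * (s / (4 * μ) * w ^ 2) :=
    mul_nonneg (by linarith [hp.definite]) (by positivity)
  have h3 : 0 ≤ K * s / 4 * G := by positivity
  rw [← sub_nonneg]
  refine (add_nonneg (add_nonneg h1 h2) h3).trans_eq ?_
  field_simp
  ring

namespace IsClassicalSolution

variable {n : ℕ} {μ : ℝ} {v w : ℝ → E n → ℝ} {g h z : Fin n → ℝ → E n → ℝ}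

/-- The weighted energy does not increase along classical solutions with compactly supported
data. -/
theorem weighted_energy_le_initial (hs : IsClassicalSolution μ v w g h z) {δ K k η : ℝ}
    (hp : AdmissibleParameters n μ δ K k η) {R : ℝ}
    (h0 : ∀ x, R < ‖x‖ → v 0 x = 0 ∧ w 0 x = 0 ∧ ∀ i, g i 0 x = 0) {T : ℝ} (hT : 0 ≤ T) :
    ∫ x, (1 + T) ^ k * Real.exp (2 * psi μ δ T x) * (v T x * w T x
        + μ / (2 * (1 + T)) * v T x ^ 2 + K * (1 + T) / 2 * (w T x ^ 2 + ∑ i, g i T x ^ 2)) ≤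
      ∫ x, (1 + 0) ^ k * Real.exp (2 * psi μ δ 0 x) * (v 0 x * w 0 x
        + μ / (2 * (1 + 0)) * v 0 x ^ 2 + K * (1 + 0) / 2 * (w 0 x ^ 2 + ∑ i, g i 0 x ^ 2)) := by
  have hμ := hp.μ_pos
  set a := μ / (2 * (2 + δ)) with ha
  have hψ : ∀ t (x : E n), psi μ δ t x = a * ‖x‖ ^ 2 / (1 + t) ^ 2 := fun t x => rfl
  have sub : Icc 0 T ×ˢ (univ : Set (E n)) ⊆ Ici 0 ×ˢ univ :=
    prod_mono Icc_subset_Ici_self subset_rfl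
  have cv : ContinuousOn (fun p : ℝ × E n => v p.1 p.2) (Icc 0 T ×ˢ univ) := hs.cont.mono sub
  have cw : ContinuousOn (fun p : ℝ × E n => w p.1 p.2) (Icc 0 T ×ˢ univ) := hs.cont_w.mono sub
  have cg : ∀ i, ContinuousOn (fun p : ℝ × E n => g i p.1 p.2) (Icc 0 T ×ˢ univ) :=
    fun i => (hs.cont_g i).mono sub
  have ch : ∀ i, ContinuousOn (fun p : ℝ × E n => h i p.1 p.2) (Icc 0 T ×ˢ univ) :=
    fun i => (hs.cont_h i).mono sub
  have cz : ∀ i, ContinuousOn (fun p : ℝ × E n => z i p.1 p.2) (Icc 0 T ×ˢ univ) :=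
    fun i => (hs.cont_z i).mono sub
  have ne : ∀ p ∈ Icc 0 T ×ˢ (univ : Set (E n)), 1 + p.1 ≠ 0 := by
    rintro ⟨t, x⟩ ⟨ht, -⟩
    have := ht.1
    simp only [ne_eq]; linarith
  have cs : ContinuousOn (fun p : ℝ × E n => (1 + p.1)⁻¹) (Icc 0 T ×ˢ univ) :=
    ContinuousOn.inv₀ (by fun_prop) ne
  have ck : ContinuousOn (fun p : ℝ × E n => (1 + p.1) ^ k) (Icc 0 T ×ˢ univ) :=
    ContinuousOn.rpow_const (by fun_prop) fun p hp => Or.inl (ne p hp)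
  -- `B` abbreviates the weight `(1 + t) ^ k * e^{2ψ}`
  set B : ℝ → E n → ℝ := fun t x => (1 + t) ^ k * Real.exp (2 * (a * ‖x‖ ^ 2 * ((1 + t)⁻¹) ^ 2))
    with hB
  have eB : ∀ t x, (1 + t) ^ k * Real.exp (2 * psi μ δ t x) = B t x := by
    intro t x
    simp only [hB, hψ, div_eq_mul_inv, inv_pow]
  have cB : ContinuousOn (fun p : ℝ × E n => B p.1 p.2) (Icc 0 T ×ˢ univ) := by
    simp only [hB]; fun_prop
  have cBx : ∀ t, Continuous (B t) := by
    intro t; simp only [hB]; fun_prop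
  have Bpos : ∀ t, 0 ≤ t → ∀ x, 0 < B t x := by
    intro t ht x
    have : 0 < 1 + t := by linarith
    simp only [hB]; positivity
  have Bt : ∀ t, 0 < t → ∀ x,
      HasDerivAt (fun s => B s x) (B t x * (k / (1 + t) - 4 * a * ‖x‖ ^ 2 / (1 + t) ^ 3)) t := by
    intro t ht x
    have hs0 : 0 < 1 + t := by linarith
    have d0 : HasDerivAt (fun s : ℝ => 1 + s) 1 t := (hasDerivAt_id t).const_add 1
    have d1 := d0.rpow_const (p := k) (Or.inl hs0.ne')
    have d2 := ((((d0.inv hs0.ne').pow 2).const_mul (a * ‖x‖ ^ 2)).const_mul 2).exp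
    refine (d1.mul d2).congr_deriv ?_
    simp only [hB, Pi.pow_apply, Pi.inv_apply, Real.rpow_sub_one hs0.ne', Nat.cast_ofNat,
      Nat.reduceSub, pow_one]
    generalize Real.exp _ = X
    field_simp
    ring
  have Bx : ∀ t i x, HasDerivAt (fun r : ℝ => B t (x + r • EuclideanSpace.single i 1))
      (B t x * (4 * a / (1 + t) ^ 2 * x i)) 0 := by
    intro t i x
    have d0 := hasDerivAt_norm_sub_sq_line x 0 i
    simp only [sub_zero] at d0
    have d1 := (((((d0.const_mul a).mul_const (((1 + t)⁻¹) ^ 2)).const_mul 2).exp).const_mul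
      ((1 + t) ^ k))
    refine d1.congr_deriv ?_
    simp only [hB, zero_smul, add_zero, div_eq_mul_inv, inv_pow]
    ring
  have far : ∀ t ∈ Icc 0 T, ∀ x ∉ Metric.closedBall (0 : E n) (R + T),
      v t x = 0 ∧ w t x = 0 ∧ ∀ i, g i t x = 0 := by
    intro t ht x hx
    rw [Metric.mem_closedBall, dist_zero_right, not_le] at hx
    exact hs.eq_zero_of_lt_norm hμ.le h0 ht.1 (by linarith [ht.2])
  simp only [eB]
  refine integral_le_of_deriv_le_divergence hT (isCompact_closedBall 0 (R + T))
    (P := fun t x => B t x * (v t x * w t x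
        + μ / (2 * (1 + t)) * v t x ^ 2 + K * (1 + t) / 2 * (w t x ^ 2 + ∑ i, g i t x ^ 2)))
    (P' := fun t x => B t x * ((k / (1 + t) - 4 * a * ‖x‖ ^ 2 / (1 + t) ^ 3) * (v t x * w t x
        + μ / (2 * (1 + t)) * v t x ^ 2 + K * (1 + t) / 2 * (w t x ^ 2 + ∑ i, g i t x ^ 2))
      + (w t x * w t x + v t x * (∑ i, h i t x - μ / (1 + t) * w t x)
        - μ / (2 * (1 + t) ^ 2) * v t x ^ 2 + μ / (2 * (1 + t)) * (2 * v t x * w t x)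
        + K / 2 * (w t x ^ 2 + ∑ i, g i t x ^ 2)
        + K * (1 + t) / 2 * (2 * w t x * (∑ i, h i t x - μ / (1 + t) * w t x)
          + 2 * ∑ i, g i t x * z i t x))))
    (X := fun i t x => B t x * (v t x * g i t x + 2 * a / (1 + t) ^ 2 * x i * v t x ^ 2
      + K * (1 + t) * (w t x * g i t x)))
    (X' := fun i t x => B t x * (4 * a / (1 + t) ^ 2 * x i) * (v t x * g i t x
        + 2 * a / (1 + t) ^ 2 * x i * v t x ^ 2 + K * (1 + t) * (w t x * g i t x))
      + B t x * (g i t x * g i t x + v t x * h i t x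
        + (2 * a / (1 + t) ^ 2 * v t x ^ 2
          + 2 * a / (1 + t) ^ 2 * x i * (2 * v t x * g i t x))
        + K * (1 + t) * (z i t x * g i t x + w t x * h i t x)))
    ?_ ?_ ?_ ?_ ?_ ?_ ?_ ?_ ?_
  · simp only [Function.uncurry_def, div_eq_mul_inv, mul_inv]
    fun_prop
  · simp only [Function.uncurry_def, div_eq_mul_inv, mul_inv, ← inv_pow]
    fun_prop
  · intro t ht x
    have hs0 : 0 < 1 + t := by linarith [ht.1]
    have d0 : HasDerivAt (fun s : ℝ => 1 + s) 1 t := (hasDerivAt_id t).const_add 1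
    have dv := hs.time t ht.1 x
    have dw := hs.equation t ht.1 x
    have dμ : HasDerivAt (fun s : ℝ => μ / (2 * (1 + s))) (-(μ / (2 * (1 + t) ^ 2))) t := by
      refine ((hasDerivAt_const t μ).div (d0.const_mul 2) (by positivity)).congr_deriv ?_
      field_simp
      ring
    have dK : HasDerivAt (fun s : ℝ => K * (1 + s) / 2) (K / 2) t :=
      ((d0.const_mul K).div_const 2).congr_deriv (by ring)
    have dG : HasDerivAt (fun s : ℝ => ∑ i, g i s x ^ 2) (2 * ∑ i, g i t x * z i t x) t := by
      refine (HasDerivAt.fun_sum fun i (_ : i ∈ Finset.univ) =>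
        (hs.time_g i t ht.1 x).pow 2).congr_deriv ?_
      rw [Finset.mul_sum]
      exact Finset.sum_congr rfl fun i _ => by simp; ring
    refine ((Bt t ht.1 x).mul (((dv.mul dw).add (dμ.mul (dv.pow 2))).add
      (dK.mul ((dw.pow 2).add dG)))).congr_deriv ?_
    simp only [Pi.add_apply, Pi.mul_apply, Pi.pow_apply]
    norm_num
    ring
  · intro t ht x hx
    obtain ⟨h1, h2, h3⟩ := far t ht x hx
    simp [h1, h2, h3]
  · intro i t ht
    have c0 := continuous_slice hs.cont ht.1.le
    have c1 := continuous_slice hs.cont_w ht.1.le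
    have c2 := continuous_slice (hs.cont_g i) ht.1.le
    have c3 := cBx t
    fun_prop
  · intro i t ht
    have c0 := continuous_slice hs.cont ht.1.le
    have c1 := continuous_slice hs.cont_w ht.1.le
    have c2 := continuous_slice (hs.cont_g i) ht.1.le
    have c3 := cBx t
    have c5 := continuous_slice (hs.cont_h i) ht.1.le
    have c6 := continuous_slice (hs.cont_z i) ht.1.le
    fun_prop
  · intro i t ht x
    have dv := hs.space i t ht.1.le x
    have dw := hs.space_w i t ht.1.le x
    have dg := hs.space_g i t ht.1.le x
    have dx : HasDerivAt (fun r : ℝ => (x + r • EuclideanSpace.single i (1 : ℝ)) i) 1 0 := by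
      have : (fun r : ℝ => (x + r • EuclideanSpace.single i (1 : ℝ)) i) = fun r => x i + r := by
        funext r; simp
      rw [this]
      exact (hasDerivAt_id (0 : ℝ)).const_add _
    have d1 := (HasDerivAt.mul dv dg).add ((dx.const_mul (2 * a / (1 + t) ^ 2)).mul
      (HasDerivAt.pow dv 2)) |>.add ((HasDerivAt.mul dw dg).const_mul (K * (1 + t)))
    refine ((Bx t i x).mul d1).congr_deriv ?_
    simp only [Pi.add_apply, Pi.mul_apply, Pi.pow_apply, zero_smul, add_zero]
    norm_num
  · intro i t ht x hx
    obtain ⟨h1, h2, h3⟩ := far t (Ioo_subset_Icc_self ht) x hx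
    simp [h1, h2, h3]
  · intro t ht x
    have hs0 : 0 < 1 + t := by linarith [ht.1]
    have key := energy_density_le hp ha hs0 (v t x) (w t x) (∑ i, h i t x) (∑ i, g i t x * z i t x)
      (Y := ‖x‖ ^ 2) (G := ∑ i, g i t x ^ 2) (S := ∑ i, x i * g i t x) (sq_nonneg _)
      (Finset.sum_nonneg fun i _ => sq_nonneg _) (by
        rw [EuclideanSpace.real_norm_sq_eq]
        exact Finset.sum_mul_sq_le_sq_mul_sq _ _ _)
    refine (mul_le_mul_of_nonneg_left key (Bpos t ht.1.le x).le).trans_eq ?_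
    have hn : (n : ℝ) * (2 * a / (1 + t) ^ 2 * v t x ^ 2)
        = ∑ _i : Fin n, 2 * a / (1 + t) ^ 2 * v t x ^ 2 := by simp
    rw [hn, EuclideanSpace.real_norm_sq_eq]
    simp only [Finset.mul_sum, Finset.sum_mul, ← Finset.sum_add_distrib]
    refine Finset.sum_congr rfl fun i _ => ?_
    field_simp
    ring

/-- The weighted `L²` bound for classical solutions with compactly supported data. -/
theorem weighted_energy_bound (hs : IsClassicalSolution μ v w g h z) {δ K k η : ℝ}
    (hp : AdmissibleParameters n μ δ K k η) {R : ℝ}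
    (h0 : ∀ x, R < ‖x‖ → v 0 x = 0 ∧ w 0 x = 0 ∧ ∀ i, g i 0 x = 0) {T : ℝ} (hT : 0 ≤ T) :
    (1 + T) ^ k * ∫ x, Real.exp (2 * psi μ δ T x) * (μ / (4 * (1 + T)) * v T x ^ 2
        + K * (1 + T) / 4 * (w T x ^ 2 + ∑ i, g i T x ^ 2)) ≤
      (1 + μ + K) * ∫ x, Real.exp (2 * psi μ δ 0 x) *
        (v 0 x ^ 2 + ∑ i, g i 0 x ^ 2 + w 0 x ^ 2) := by
  have hT1 : 0 < 1 + T := by linarith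
  have hμ := hp.μ_pos
  have hK := hp.K_pos
  have cψ : ∀ t, Continuous fun x : E n => Real.exp (2 * psi μ δ t x) := by
    intro t; simp only [psi]; fun_prop
  have hG : ∀ t x, 0 ≤ ∑ i, g i t x ^ 2 := fun t x => Finset.sum_nonneg fun i _ => sq_nonneg _
  have int : ∀ t, 0 ≤ t → ∀ α β γ σ : ℝ, Integrable fun x : E n =>
      α * Real.exp (2 * psi μ δ t x) * (β * (v t x * w t x) + γ * v t x ^ 2
        + σ * (w t x ^ 2 + ∑ i, g i t x ^ 2)) := by
    intro t ht α β γ σ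
    refine Continuous.integrable_of_hasCompactSupport ?_
      (HasCompactSupport.intro (isCompact_closedBall 0 (R + t)) fun x hx => ?_)
    · have c0 := continuous_slice hs.cont ht
      have c1 := continuous_slice hs.cont_w ht
      have c2 := fun i => continuous_slice (hs.cont_g i) ht
      have c3 := cψ t
      fun_prop
    · rw [Metric.mem_closedBall, dist_zero_right, not_le] at hx
      obtain ⟨h1, h2, h3⟩ := hs.eq_zero_of_lt_norm hμ.le h0 ht hx
      simp [h1, h2, h3]
  rw [← integral_const_mul, ← integral_const_mul]
  refine le_trans ?_ ((hs.weighted_energy_le_initial hp h0 hT).trans ?_)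
  · refine integral_mono ?_ ?_ fun x => ?_
    · refine (int T hT ((1 + T) ^ k) 0 (μ / (4 * (1 + T)))
        (K * (1 + T) / 4)).congr (Filter.Eventually.of_forall fun x => ?_)
      dsimp only
      ring
    · refine (int T hT ((1 + T) ^ k) 1 (μ / (2 * (1 + T)))
        (K * (1 + T) / 2)).congr (Filter.Eventually.of_forall fun x => ?_)
      dsimp only
      ring
    · dsimp only
      rw [← mul_assoc]
      exact mul_le_mul_of_nonneg_left (hp.le_density hT1 _ _ (hG T x)) (by positivity)
  · refine integral_mono ?_ ?_ fun x => ?_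
    · refine (int 0 le_rfl ((1 + 0) ^ k) 1 (μ / (2 * (1 + 0)))
        (K * (1 + 0) / 2)).congr (Filter.Eventually.of_forall fun x => ?_)
      dsimp only
      ring
    · refine (int 0 le_rfl (1 + μ + K) 0 1 1).congr (Filter.Eventually.of_forall fun x => ?_)
      dsimp only
      ring
    · dsimp only
      rw [add_zero, Real.one_rpow, one_mul, mul_left_comm]
      refine mul_le_mul_of_nonneg_left ?_ (Real.exp_pos _).le
      have := hG 0 x
      nlinarith [sq_nonneg (v 0 x - w 0 x), sq_nonneg (v 0 x), sq_nonneg (w 0 x),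
        mul_nonneg hμ.le (sq_nonneg (v 0 x)), mul_nonneg hμ.le (sq_nonneg (w 0 x)),
        mul_nonneg hK.le (sq_nonneg (v 0 x)), mul_nonneg hK.le (sq_nonneg (w 0 x)),
        mul_nonneg hK.le this, mul_nonneg hμ.le this]

end IsClassicalSolution

/-! ### Mollification in the space variable -/

theorem H1.hasWeakGradient {n : ℕ} (f : H1 n) : HasWeakGradient (f.fn) (f.grad) := f.2

/-- The convolution `x ↦ ∫ f(y) ρ(x - y) dy`. -/
def mollify {n : ℕ} (ρ f : E n → ℝ) (x : E n) : ℝ := ∫ y, f y * ρ (x - y)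

theorem mollify_eq_convolution {n : ℕ} (ρ f : E n → ℝ) :
    mollify ρ f = convolution f ρ (ContinuousLinearMap.mul ℝ ℝ) volume := rfl

namespace IsTestFunction

variable {n : ℕ} {ρ : E n → ℝ}

theorem fderiv_apply (h : IsTestFunction ρ) (e : E n) :
    IsTestFunction fun x => fderiv ℝ ρ x e :=
  ⟨(h.1.fderiv_right (m := ∞) (by simp)).clm_apply contDiff_const, h.2.fderiv_apply (𝕜 := ℝ) e⟩

theorem comp_sub_left (h : IsTestFunction ρ) (x : E n) : IsTestFunction fun y => ρ (x - y) :=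
  ⟨h.1.comp (contDiff_const.sub contDiff_id), h.2.comp_homeomorph (Homeomorph.subLeft x)⟩

theorem fderiv_comp_sub_left (h : IsTestFunction ρ) (x y e : E n) :
    fderiv ℝ (fun y => ρ (x - y)) y e = -fderiv ℝ ρ (x - y) e := by
  have h1 : HasFDerivAt ρ (fderiv ℝ ρ (x - y)) (x - y) :=
    (h.1.differentiable (by simp) _).hasFDerivAt
  have h2 : HasFDerivAt (fun y : E n => x - y) (-ContinuousLinearMap.id ℝ (E n)) y :=
    (hasFDerivAt_id y).const_sub x
  have h3 : HasFDerivAt (fun y => ρ (x - y)) _ y := h1.comp y h2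
  rw [h3.fderiv]
  simp

theorem continuous_mollify (h : IsTestFunction ρ) {f : E n → ℝ} (hf : LocallyIntegrable f) :
    Continuous (mollify ρ f) :=
  h.2.continuous_convolution_right (ContinuousLinearMap.mul ℝ ℝ) hf h.1.continuous

theorem hasLineDerivAt_mollify (h : IsTestFunction ρ) {f : E n → ℝ} (hf : LocallyIntegrable f)
    (x e : E n) :
    HasLineDerivAt ℝ (mollify ρ f) (mollify (fun y => fderiv ℝ ρ y e) f x) x e := by
  have h1 : ContDiff ℝ 1 ρ := h.1.of_le (by simp)
  have := (h.2.hasFDerivAt_convolution_right (ContinuousLinearMap.mul ℝ ℝ) hf h1 x).hasLineDerivAt e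
  rw [convolution_precompR_apply _ hf (h.2.fderiv (𝕜 := ℝ)) (h1.continuous_fderiv (by simp))]
    at this
  exact this

/-- The functional `f ↦ (f * ρ)(x)` on `L²`. -/
def mollifyCLM (h : IsTestFunction ρ) (x : E n) : L2 n →L[ℝ] ℝ :=
  innerSL ℝ ((h.comp_sub_left x).memLp.toLp _)

theorem mollifyCLM_apply (h : IsTestFunction ρ) (x : E n) (f : L2 n) :
    h.mollifyCLM x f = mollify ρ f x := by
  rw [mollifyCLM, innerSL_apply_apply, L2.inner_def, mollify]
  apply integral_congr_ae
  filter_upwards [(h.comp_sub_left x).memLp.coeFn_toLp] with y hy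
  rw [hy]
  rfl

theorem norm_mollifyCLM_le (h : IsTestFunction ρ) (x : E n) :
    ‖h.mollifyCLM x‖ ≤ ‖h.memLp.toLp ρ‖ := by
  rw [mollifyCLM, innerSL_apply_norm, Lp.norm_toLp, Lp.norm_toLp]
  apply le_of_eq
  congr 1
  exact eLpNorm_comp_measurePreserving h.memLp.1 (Measure.measurePreserving_sub_left volume x)

theorem continuous_mollify_prod (h : IsTestFunction ρ) :
    Continuous fun p : L2 n × E n => mollify ρ p.1 p.2 := by
  refine continuous_prod_of_continuous_lipschitzWith _ ‖h.memLp.toLp ρ‖₊ (fun f => ?_) fun x => ?_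
  · exact h.continuous_mollify ((Lp.memLp f).locallyIntegrable (by norm_num))
  · simp only [← h.mollifyCLM_apply]
    exact (h.mollifyCLM x).lipschitz.weaken (h.norm_mollifyCLM_le x)

theorem continuousOn_mollify (h : IsTestFunction ρ) {f : ℝ → L2 n} {s : Set ℝ}
    (hf : ContinuousOn f s) :
    ContinuousOn (Function.uncurry fun t x => mollify ρ (f t) x) (s ×ˢ univ) :=
  h.continuous_mollify_prod.comp_continuousOn
    ((hf.comp continuousOn_fst fun _ hp => hp.1).prodMk continuousOn_snd)

theorem hasDerivAt_mollify (h : IsTestFunction ρ) {f : ℝ → L2 n} {f' : L2 n} {t : ℝ}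
    (hf : HasDerivAt f f' t) (x : E n) :
    HasDerivAt (fun s => mollify ρ (f s) x) (mollify ρ f' x) t := by
  simp only [← h.mollifyCLM_apply]
  exact (h.mollifyCLM x).hasFDerivAt.comp_hasDerivAt t hf

/-- Derivatives can be moved from the mollifier to the weak gradient. -/
theorem mollify_fderiv (h : IsTestFunction ρ) {f : E n → ℝ} {G : E n → E n}
    (hG : HasWeakGradient f G) (e x : E n) :
    mollify (fun y => fderiv ℝ ρ y e) f x = mollify ρ (fun y => inner ℝ (G y) e) x := by
  have := hG _ (h.comp_sub_left x) e
  simp only [h.fderiv_comp_sub_left, mul_neg, integral_neg, neg_inj] at this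
  exact this

theorem integral_inner_gradient (h : IsTestFunction ρ) (f : H1 n) (x : E n) :
    ∫ y, inner ℝ (f.grad y) (gradient (fun y => ρ (x - y)) y) =
      -∑ i, mollify (fun y => fderiv ℝ (fun y => fderiv ℝ ρ y (EuclideanSpace.single i 1)) y
        (EuclideanSpace.single i 1)) f.fn x := by
  have e1 : ∀ y, inner ℝ (f.grad y) (gradient (fun y => ρ (x - y)) y)
      = ∑ i, -(inner ℝ (f.grad y) (EuclideanSpace.single i (1 : ℝ))
          * fderiv ℝ ρ (x - y) (EuclideanSpace.single i 1)) := by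
    intro y
    rw [PiLp.inner_apply]
    refine Finset.sum_congr rfl fun i _ => ?_
    have e2 : (gradient (fun y => ρ (x - y)) y) i
        = -fderiv ℝ ρ (x - y) (EuclideanSpace.single i 1) := by
      rw [← h.fderiv_comp_sub_left, ← inner_gradient_left, EuclideanSpace.inner_single_right]
      simp
    rw [e2, EuclideanSpace.inner_single_right]
    simp
    ring
  have e3 : ∀ i : Fin n, Integrable fun y => -(inner ℝ (f.grad y) (EuclideanSpace.single i (1 : ℝ))
      * fderiv ℝ ρ (x - y) (EuclideanSpace.single i 1)) := fun i =>
    (integrable_inner_mul f.grad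
      ((h.fderiv_apply (EuclideanSpace.single i 1)).comp_sub_left x) _).neg
  simp only [e1]
  rw [integral_finsetSum _ fun i _ => e3 i, ← Finset.sum_neg_distrib]
  refine Finset.sum_congr rfl fun i _ => ?_
  rw [integral_neg, (h.fderiv_apply (EuclideanSpace.single i 1)).mollify_fderiv f.hasWeakGradient]
  rfl

end IsTestFunction

/-- Mollifying a weak solution in space gives a classical solution: the equation is invariant
under spatial translations. -/
theorem IsSolution.isClassicalSolution_mollify {n : ℕ} {μ : ℝ} {u₀ : H1 n} {u₁ : L2 n}
    {u : ℝ → H1 n} {ut : ℝ → L2 n} (hu : IsSolution μ u₀ u₁ u ut) {ρ : E n → ℝ}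
    (hρ : IsTestFunction ρ) :
    IsClassicalSolution μ (fun t => mollify ρ (u t).fn) (fun t => mollify ρ (ut t))
      (fun i t => mollify (fun y => fderiv ℝ ρ y (EuclideanSpace.single i 1)) (u t).fn)
      (fun i t => mollify (fun y => fderiv ℝ (fun y => fderiv ℝ ρ y (EuclideanSpace.single i 1)) y
        (EuclideanSpace.single i 1)) (u t).fn)
      (fun i t => mollify (fun y => fderiv ℝ ρ y (EuclideanSpace.single i 1)) (ut t)) := by
  have hρ1 := fun i : Fin n => hρ.fderiv_apply (EuclideanSpace.single i 1)
  have hρ2 := fun i : Fin n => (hρ1 i).fderiv_apply (EuclideanSpace.single i 1)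
  have cu : ContinuousOn (fun t => (u t).fn) (Ici 0) := fun t ht =>
    (hu.hasDerivWithinAt t ht).continuousWithinAt
  have du : ∀ t, 0 < t → HasDerivAt (fun s => (u s).fn) (ut t) t := fun t ht =>
    (hu.hasDerivWithinAt t ht.le).hasDerivAt (Ici_mem_nhds ht)
  have li : ∀ f : L2 n, LocallyIntegrable f := fun f =>
    (Lp.memLp f).locallyIntegrable (by norm_num)
  refine ⟨hρ.continuousOn_mollify cu, hρ.continuousOn_mollify hu.continuousOn_deriv,
    fun i => (hρ1 i).continuousOn_mollify cu, fun i => (hρ2 i).continuousOn_mollify cu,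
    fun i => (hρ1 i).continuousOn_mollify hu.continuousOn_deriv,
    fun t ht x => hρ.hasDerivAt_mollify (du t ht) x,
    fun i t ht x => (hρ1 i).hasDerivAt_mollify (du t ht) x, fun t ht x => ?_,
    fun i t _ x => hρ.hasLineDerivAt_mollify (li _) x _,
    fun i t _ x => hρ.hasLineDerivAt_mollify (li _) x _,
    fun i t _ x => (hρ1 i).hasLineDerivAt_mollify (li _) x _⟩
  have := hu.equation _ (hρ.comp_sub_left x) t ht
  rw [hρ.integral_inner_gradient, neg_neg] at this
  exact this

/-! ### Mollified data -/

/-- The weak gradient vanishes almost everywhere outside a ball which contains the support. -/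
theorem H1.grad_ae_eq_zero {n : ℕ} {f : H1 n} {R : ℝ}
    (hf : ∀ᵐ x : E n, R < ‖x‖ → f.fn x = 0) : ∀ᵐ x : E n, R < ‖x‖ → f.grad x = 0 := by
  have hU : IsOpen {x : E n | R < ‖x‖} := isOpen_lt continuous_const continuous_norm
  have key : ∀ i : Fin n, ∀ᵐ x : E n, x ∈ {x : E n | R < ‖x‖} →
      inner ℝ (f.grad x) (EuclideanSpace.single i (1 : ℝ)) = 0 := by
    intro i
    refine hU.ae_eq_zero_of_integral_contDiff_smul_eq_zero
      ((((Lp.memLp f.grad).inner_const _).locallyIntegrable (by norm_num)).locallyIntegrableOn _)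
      fun φ hφ hφc hφU => ?_
    have h1 := f.hasWeakGradient φ ⟨hφ, hφc⟩ (EuclideanSpace.single i 1)
    have h2 : ∫ x, f.fn x * fderiv ℝ φ x (EuclideanSpace.single i 1) = 0 := by
      refine integral_eq_zero_of_ae ?_
      filter_upwards [hf] with x hx
      by_cases hxU : R < ‖x‖
      · simp [hx hxU]
      · have : x ∉ tsupport (fderiv ℝ φ) := fun h' => hxU (hφU (tsupport_fderiv_subset ℝ h'))
        simp [image_eq_zero_of_notMem_tsupport this]
    rw [h2, eq_comm, neg_eq_zero] at h1
    simpa [mul_comm] using h1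
  filter_upwards [ae_all_iff.2 key] with x hx hxR
  ext i
  simpa [EuclideanSpace.inner_single_right] using hx i hxR

variable {n : ℕ} {ρ f : E n → ℝ}

theorem mollify_eq_zero {R r : ℝ} (hρ : ∀ x, r < ‖x‖ → ρ x = 0)
    (hf : ∀ᵐ x : E n, R < ‖x‖ → f x = 0) {x : E n} (hx : R + r < ‖x‖) : mollify ρ f x = 0 := by
  refine integral_eq_zero_of_ae ?_
  filter_upwards [hf] with y hy
  rcases lt_or_ge R ‖y‖ with h | h
  · simp [hy h]
  · have := norm_sub_norm_le x y
    simp [hρ (x - y) (by linarith)]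

theorem IsTestFunction.integrable_mul_comp_sub_left (hρ : IsTestFunction ρ) {F : E n → ℝ}
    (hF : Integrable F) (x : E n) : Integrable fun y => F y * ρ (x - y) := by
  have hρx := hρ.comp_sub_left x
  obtain ⟨C, hC⟩ := hρx.2.exists_bound_of_continuous hρx.1.continuous
  exact hF.mul_bdd hρx.1.continuous.aestronglyMeasurable (Filter.Eventually.of_forall hC)

/-- Jensen's inequality for the average `mollify ρ f x`. -/
theorem mollify_sq_le (hρ : IsTestFunction ρ) (h0 : ∀ x, 0 ≤ ρ x) (h1 : ∫ x, ρ x = 1)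
    (hf : MemLp f 2 volume) (x : E n) : mollify ρ f x ^ 2 ≤ mollify ρ (fun y => f y ^ 2) x := by
  set m := mollify ρ f x with hm
  have hρx := hρ.comp_sub_left x
  have i0 : Integrable fun y => ρ (x - y) := hρx.1.continuous.integrable_of_hasCompactSupport hρx.2
  have i1 : Integrable fun y => f y * ρ (x - y) := hf.integrable_mul hρx.memLp
  have i2 : Integrable fun y => f y ^ 2 * ρ (x - y) :=
    hρ.integrable_mul_comp_sub_left hf.integrable_sq x
  have i3 : Integrable fun y => f y ^ 2 * ρ (x - y) - 2 * m * (f y * ρ (x - y)) :=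
    i2.sub (i1.const_mul _)
  -- the variance of `f` with respect to the density `ρ (x - ·)` is nonnegative
  have hvar : 0 ≤ ∫ y, (f y - m) ^ 2 * ρ (x - y) :=
    integral_nonneg fun y => mul_nonneg (sq_nonneg _) (h0 _)
  have e : ∀ y, (f y - m) ^ 2 * ρ (x - y)
      = f y ^ 2 * ρ (x - y) - 2 * m * (f y * ρ (x - y)) + m ^ 2 * ρ (x - y) := fun y => by ring
  simp only [e] at hvar
  rw [integral_add i3 (i0.const_mul _),
    integral_sub i2 (i1.const_mul _), integral_const_mul, integral_const_mul,
    integral_sub_left_eq_self ρ volume x, h1] at hvar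
  change 0 ≤ mollify ρ (fun y => f y ^ 2) x - 2 * m * m + m ^ 2 * 1 at hvar
  linarith

theorem integrable_exp_mul_sq {c R : ℝ} (hc : 0 ≤ c) (hf : MemLp f 2 volume)
    (hR : ∀ᵐ x : E n, R < ‖x‖ → f x = 0) :
    Integrable fun x => Real.exp (c * ‖x‖ ^ 2) * f x ^ 2 := by
  have hc' : Continuous fun x : E n => Real.exp (c * ‖x‖ ^ 2) := by fun_prop
  refine (hf.integrable_sq.const_mul (Real.exp (c * R ^ 2))).mono'
    (hc'.aestronglyMeasurable.mul hf.integrable_sq.1) ?_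
  filter_upwards [hR] with x hx
  rw [Real.norm_of_nonneg (by positivity)]
  rcases lt_or_ge R ‖x‖ with h | h
  · simp [hx h]
  · gcongr

/-- Mollification at a scale `r` which is small in comparison with the size `R` of the support at
most doubles an `L²` norm with Gaussian weight. -/
theorem integral_exp_mul_mollify_sq_le (hρ : IsTestFunction ρ) (h0 : ∀ x, 0 ≤ ρ x)
    (h1 : ∫ x, ρ x = 1) {r R c : ℝ} (hρr : ∀ x, r < ‖x‖ → ρ x = 0)
    (hf : MemLp f 2 volume) (hR : ∀ᵐ x : E n, R < ‖x‖ → f x = 0) (hc : 0 ≤ c)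
    (hr : 0 ≤ r) (hcr : Real.exp (c * (2 * R * r + r ^ 2)) ≤ 2) :
    ∫ x, Real.exp (c * ‖x‖ ^ 2) * mollify ρ f x ^ 2
      ≤ 2 * ∫ x, Real.exp (c * ‖x‖ ^ 2) * f x ^ 2 := by
  set F : E n → ℝ := fun x => Real.exp (c * ‖x‖ ^ 2) * f x ^ 2 with hF
  have iF : Integrable F := integrable_exp_mul_sq hc hf hR
  have iρ : Integrable ρ := hρ.1.continuous.integrable_of_hasCompactSupport hρ.2
  have iM : Integrable (mollify ρ F) := iF.integrable_convolution (ContinuousLinearMap.mul ℝ ℝ) iρ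
  have eM : ∫ x, mollify ρ F x = ∫ x, F x := by
    have := integral_convolution (ContinuousLinearMap.mul ℝ ℝ) iF iρ
    rw [h1] at this
    simpa [mollify_eq_convolution] using this
  rw [← eM, ← integral_const_mul]
  refine integral_mono_of_nonneg (Filter.Eventually.of_forall fun x => by positivity)
    (iM.const_mul 2) (Filter.Eventually.of_forall fun x => ?_)
  dsimp only
  refine (mul_le_mul_of_nonneg_left (mollify_sq_le hρ h0 h1 hf x) (Real.exp_pos _).le).trans ?_
  simp only [mollify]
  rw [← integral_const_mul, ← integral_const_mul]
  refine integral_mono_ae ?_ ?_ ?_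
  · exact (hρ.integrable_mul_comp_sub_left hf.integrable_sq x).const_mul _
  · exact (hρ.integrable_mul_comp_sub_left iF x).const_mul _
  · filter_upwards [hR] with y hy
    rcases lt_or_ge R ‖y‖ with h | h
    · simp [hF, hy h]
    rcases lt_or_ge r ‖x - y‖ with h' | h'
    · simp [hρr _ h']
    have hxy : ‖x‖ ≤ ‖y‖ + r := by linarith [norm_sub_norm_le x y]
    have hsq : ‖x‖ ^ 2 ≤ ‖y‖ ^ 2 + (2 * R * r + r ^ 2) := by
      nlinarith [norm_nonneg x, norm_nonneg y]
    have hexp : Real.exp (c * ‖x‖ ^ 2) ≤ 2 * Real.exp (c * ‖y‖ ^ 2) := by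
      calc Real.exp (c * ‖x‖ ^ 2)
          ≤ Real.exp (c * (2 * R * r + r ^ 2) + c * ‖y‖ ^ 2) := by
            apply Real.exp_le_exp.2
            nlinarith
        _ = Real.exp (c * (2 * R * r + r ^ 2)) * Real.exp (c * ‖y‖ ^ 2) := Real.exp_add _ _
        _ ≤ _ := by gcongr
    have := mul_le_mul_of_nonneg_right hexp (mul_nonneg (sq_nonneg (f y)) (h0 (x - y)))
    simp only [hF]
    linarith

/-! ### Passage to the limit -/

/-- A sequence of mollifiers concentrating at the origin. -/
def bump (n k : ℕ) : ContDiffBump (0 : E n) where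
  rIn := 1 / ((k : ℝ) + 1) / 2
  rOut := 1 / ((k : ℝ) + 1)
  rIn_pos := by positivity
  rIn_lt_rOut := half_lt_self (by positivity)

theorem isTestFunction_bump (n k : ℕ) : IsTestFunction ((bump n k).normed volume) :=
  ⟨(bump n k).contDiff_normed, (bump n k).hasCompactSupport_normed⟩

theorem bump_eq_zero {n k : ℕ} {x : E n} (hx : 1 / ((k : ℝ) + 1) < ‖x‖) :
    (bump n k).normed volume x = 0 := by
  have : x ∉ Function.support ((bump n k).normed volume) := by
    rw [(bump n k).support_normed_eq, Metric.mem_ball, dist_zero_right, not_lt]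
    exact hx.le
  simpa using this

theorem ae_tendsto_mollify_bump {f : E n → ℝ} (hf : LocallyIntegrable f) :
    ∀ᵐ x, Filter.Tendsto (fun k => mollify ((bump n k).normed volume) f x) Filter.atTop
      (nhds (f x)) := by
  have := ContDiffBump.ae_convolution_tendsto_right_of_locallyIntegrable (μ := volume)
    (φ := bump n) (l := Filter.atTop) (K := 2)
    (tendsto_one_div_add_atTop_nhds_zero_nat (𝕜 := ℝ))
    (Filter.Eventually.of_forall fun k => by simp only [bump]; linarith) hf
  filter_upwards [this] with x hx
  refine hx.congr fun k => ?_
  rw [convolution_eq_swap, mollify]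
  exact integral_congr_ae (Filter.Eventually.of_forall fun y => by simp [mul_comm])

/-- Fatou's lemma for nonnegative integrable functions with bounded integrals. -/
theorem integrable_and_integral_le_of_tendsto {α : Type*} [MeasurableSpace α] {ν : Measure α}
    {F : ℕ → α → ℝ} {G : α → ℝ} {B : ℝ} (hF : ∀ k, Integrable (F k) ν) (hF0 : ∀ k x, 0 ≤ F k x)
    (hB : ∀ᶠ k in Filter.atTop, ∫ x, F k x ∂ν ≤ B)
    (hlim : ∀ᵐ x ∂ν, Filter.Tendsto (fun k => F k x) Filter.atTop (nhds (G x))) :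
    Integrable G ν ∧ ∫ x, G x ∂ν ≤ B := by
  have hG0 : 0 ≤ᵐ[ν] G := by
    filter_upwards [hlim] with x hx using ge_of_tendsto' hx fun k => hF0 k x
  have hGm : AEStronglyMeasurable G ν :=
    aestronglyMeasurable_of_tendsto_ae Filter.atTop (fun k => (hF k).1) hlim
  have hB0 : 0 ≤ B := by
    obtain ⟨k, hk⟩ := hB.exists
    exact (integral_nonneg (hF0 k)).trans hk
  have hle : ∫⁻ x, ENNReal.ofReal (G x) ∂ν ≤ ENNReal.ofReal B := by
    calc ∫⁻ x, ENNReal.ofReal (G x) ∂ν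
        = ∫⁻ x, Filter.liminf (fun k => ENNReal.ofReal (F k x)) Filter.atTop ∂ν := by
          apply lintegral_congr_ae
          filter_upwards [hlim] with x hx
          exact ((ENNReal.continuous_ofReal.tendsto _).comp hx).liminf_eq.symm
      _ ≤ Filter.liminf (fun k => ∫⁻ x, ENNReal.ofReal (F k x) ∂ν) Filter.atTop :=
          lintegral_liminf_le' fun k => (hF k).1.aemeasurable.ennreal_ofReal
      _ ≤ ENNReal.ofReal B := by
          apply Filter.liminf_le_of_frequently_le'
          refine Filter.Eventually.frequently ?_
          filter_upwards [hB] with k hk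
          rw [← ofReal_integral_eq_lintegral_ofReal (hF k) (Filter.Eventually.of_forall (hF0 k))]
          exact ENNReal.ofReal_le_ofReal hk
  have hGi : Integrable G ν :=
    ⟨hGm, (hasFiniteIntegral_iff_ofReal hG0).2 (hle.trans_lt ENNReal.ofReal_lt_top)⟩
  refine ⟨hGi, ?_⟩
  rw [← ofReal_integral_eq_lintegral_ofReal hGi hG0] at hle
  exact (ENNReal.ofReal_le_ofReal_iff hB0).1 hle

theorem norm_sq_eq_sum_inner_single {n : ℕ} (x : E n) :
    ‖x‖ ^ 2 = ∑ i, (inner ℝ x (EuclideanSpace.single i (1 : ℝ))) ^ 2 := by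
  rw [EuclideanSpace.real_norm_sq_eq]
  exact Finset.sum_congr rfl fun i _ => by simp [EuclideanSpace.inner_single_right]

theorem integral_mul_add_sum_add {n : ℕ} {W a b : E n → ℝ} {g : Fin n → E n → ℝ}
    (ha : Integrable fun x => W x * a x) (hg : ∀ i, Integrable fun x => W x * g i x)
    (hb : Integrable fun x => W x * b x) :
    ∫ x, W x * (a x + ∑ i, g i x + b x)
      = (∫ x, W x * a x) + (∑ i, ∫ x, W x * g i x) + ∫ x, W x * b x := by
  have hs : Integrable fun x => ∑ i, W x * g i x := integrable_finsetSum _ fun i _ => hg i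
  have hs' : Integrable fun x => W x * a x + ∑ i, W x * g i x := ha.add hs
  rw [← integral_finsetSum _ fun i _ => hg i, ← integral_add ha hs, ← integral_add hs' hb]
  simp only [mul_add, Finset.mul_sum]

/-- The weighted energy bound for weak solutions. -/
theorem IsSolution.weighted_energy_bound {n : ℕ} {μ δ K k η : ℝ}
    (hp : AdmissibleParameters n μ δ K k η) {u₀ : H1 n} {u₁ : L2 n}
    (hu₀ : CompactlySupported u₀.fn) (hu₁ : CompactlySupported u₁) {u : ℝ → H1 n} {ut : ℝ → L2 n}
    (hu : IsSolution μ u₀ u₁ u ut) {t : ℝ} (ht : 0 ≤ t) :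
    Integrable (fun x => Real.exp (2 * psi μ δ t x) * (μ / (4 * (1 + t)) * (u t).fn x ^ 2
        + K * (1 + t) / 4 * (ut t x ^ 2 + ‖(u t).grad x‖ ^ 2))) ∧
      ∫ x, Real.exp (2 * psi μ δ t x) * (μ / (4 * (1 + t)) * (u t).fn x ^ 2
        + K * (1 + t) / 4 * (ut t x ^ 2 + ‖(u t).grad x‖ ^ 2)) ≤
      ((1 + t) ^ k)⁻¹ * ((1 + μ + K) * (2 * initialEnergy μ δ u₀ u₁)) := by
  have hμ := hp.μ_pos
  have hδ := hp.δ_pos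
  have hK := hp.K_pos
  have hs0 : 0 < 1 + t := by linarith
  obtain ⟨R₀, hR₀⟩ := hu₀
  obtain ⟨R₁, hR₁⟩ := hu₁
  set R := max R₀ R₁ with hR
  have hf : ∀ᵐ x : E n, R < ‖x‖ → u₀.fn x = 0 := by
    filter_upwards [hR₀] with x hx h using hx ((le_max_left _ _).trans_lt h)
  have hf₁ : ∀ᵐ x : E n, R < ‖x‖ → u₁ x = 0 := by
    filter_upwards [hR₁] with x hx h using hx ((le_max_right _ _).trans_lt h)
  have hG : ∀ i : Fin n, ∀ᵐ x : E n, R < ‖x‖ →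
      inner ℝ (u₀.grad x) (EuclideanSpace.single i (1 : ℝ)) = 0 := by
    intro i
    filter_upwards [H1.grad_ae_eq_zero hf] with x hx h
    rw [hx h, inner_zero_left]
  have mG : ∀ (f : H1 n) (i : Fin n),
      MemLp (fun x => inner ℝ (f.grad x) (EuclideanSpace.single i (1 : ℝ))) 2 volume :=
    fun f i => (Lp.memLp f.grad).inner_const _
  have cexp : ∀ s, Continuous fun x : E n => Real.exp (2 * psi μ δ s x) := by
    intro s; simp only [psi]; fun_prop
  -- the mollified solutions
  set ρ : ℕ → E n → ℝ := fun j => (bump n j).normed volume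
  have hρ : ∀ j, IsTestFunction (ρ j) := isTestFunction_bump n
  have hρ0 : ∀ j x, 0 ≤ ρ j x := fun j x => (bump n j).nonneg_normed x
  have hρ1 : ∀ j, ∫ x, ρ j x = 1 := fun j => (bump n j).integral_normed
  have hρr : ∀ (j : ℕ) (x : E n), 1 / ((j : ℝ) + 1) < ‖x‖ → ρ j x = 0 :=
    fun j x hx => bump_eq_zero hx
  set v : ℕ → ℝ → E n → ℝ := fun j s => mollify (ρ j) (u s).fn with hv
  set w : ℕ → ℝ → E n → ℝ := fun j s => mollify (ρ j) (ut s) with hw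
  set g : ℕ → Fin n → ℝ → E n → ℝ := fun j i s =>
    mollify (fun y => fderiv ℝ (ρ j) y (EuclideanSpace.single i 1)) (u s).fn with hg
  have eg : ∀ j i s, g j i s
      = mollify (ρ j) (fun y => inner ℝ ((u s).grad y) (EuclideanSpace.single i (1 : ℝ))) := by
    intro j i s
    funext x
    exact (hρ j).mollify_fderiv (u s).hasWeakGradient _ x
  have hcl := fun j => hu.isClassicalSolution_mollify (hρ j)
  have hdata : ∀ j x, R + 1 < ‖x‖ → v j 0 x = 0 ∧ w j 0 x = 0 ∧ ∀ i, g j i 0 x = 0 := by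
    intro j x hx
    have h1 : R + 1 / ((j : ℝ) + 1) < ‖x‖ := by
      have : 1 / ((j : ℝ) + 1) ≤ 1 := by
        rw [div_le_one (by positivity)]
        linarith [(Nat.cast_nonneg j : (0 : ℝ) ≤ j)]
      linarith
    refine ⟨?_, ?_, fun i => ?_⟩
    · simp only [hv, hu.initial]
      exact mollify_eq_zero (hρr j) hf h1
    · simp only [hw, hu.initial_deriv]
      exact mollify_eq_zero (hρr j) hf₁ h1
    · rw [eg, hu.initial]
      exact mollify_eq_zero (hρr j) (hG i) h1
  -- the initial energies of the mollified solutions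
  set c := 2 * (μ / (2 * (2 + δ))) with hc
  have hc0 : 0 ≤ c := by positivity
  have eψ : ∀ x : E n, Real.exp (2 * psi μ δ 0 x) = Real.exp (c * ‖x‖ ^ 2) := by
    intro x
    simp only [psi, hc, add_zero, one_pow, div_one, mul_assoc]
  have hI : initialEnergy μ δ u₀ u₁ = (∫ x, Real.exp (c * ‖x‖ ^ 2) * u₀.fn x ^ 2)
      + (∑ i, ∫ x, Real.exp (c * ‖x‖ ^ 2)
        * inner ℝ (u₀.grad x) (EuclideanSpace.single i (1 : ℝ)) ^ 2)
      + ∫ x, Real.exp (c * ‖x‖ ^ 2) * u₁ x ^ 2 := by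
    have i0 := integrable_exp_mul_sq hc0 (Lp.memLp u₀.fn) hf
    have i1 := integrable_exp_mul_sq hc0 (Lp.memLp u₁) hf₁
    have i2 := fun i => integrable_exp_mul_sq hc0 (mG u₀ i) (hG i)
    rw [← integral_mul_add_sum_add i0 i2 i1, initialEnergy]
    simp only [eψ, norm_sq_eq_sum_inner_single]
  have hinit : ∀ᶠ j in Filter.atTop, ∫ x, Real.exp (2 * psi μ δ 0 x) *
      (v j 0 x ^ 2 + ∑ i, g j i 0 x ^ 2 + w j 0 x ^ 2) ≤ 2 * initialEnergy μ δ u₀ u₁ := by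
    have hlim : Filter.Tendsto (fun j : ℕ => Real.exp (c * (2 * R * (1 / ((j : ℝ) + 1))
        + (1 / ((j : ℝ) + 1)) ^ 2))) Filter.atTop (nhds 1) := by
      have h1 := tendsto_one_div_add_atTop_nhds_zero_nat (𝕜 := ℝ)
      have h2 := (((h1.const_mul (2 * R)).add (h1.pow 2)).const_mul c)
      have h3 := (Real.continuous_exp.tendsto _).comp h2
      simpa [Function.comp_def] using h3
    filter_upwards [hlim.eventually (Iio_mem_nhds one_lt_two)] with j hj
    have hr : (0 : ℝ) ≤ 1 / ((j : ℝ) + 1) := by positivity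
    have icpt : ∀ f : E n → ℝ, Continuous f → (∀ x, R + 1 < ‖x‖ → f x = 0) →
        Integrable fun x => Real.exp (c * ‖x‖ ^ 2) * f x ^ 2 := by
      intro f hfc hf0
      refine Continuous.integrable_of_hasCompactSupport (by fun_prop)
        (HasCompactSupport.intro (isCompact_closedBall 0 (R + 1)) fun x hx => ?_)
      rw [Metric.mem_closedBall, dist_zero_right, not_le] at hx
      simp [hf0 x hx]
    have i0 := icpt (v j 0) (continuous_slice (hcl j).cont le_rfl) fun x hx => (hdata j x hx).1
    have i1 := icpt (w j 0) (continuous_slice (hcl j).cont_w le_rfl) fun x hx => (hdata j x hx).2.1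
    have i2 := fun i => icpt (g j i 0) (continuous_slice ((hcl j).cont_g i) le_rfl)
      fun x hx => (hdata j x hx).2.2 i
    have hsplit : ∫ x, Real.exp (2 * psi μ δ 0 x) *
        (v j 0 x ^ 2 + ∑ i, g j i 0 x ^ 2 + w j 0 x ^ 2)
        = (∫ x, Real.exp (c * ‖x‖ ^ 2) * v j 0 x ^ 2)
          + (∑ i, ∫ x, Real.exp (c * ‖x‖ ^ 2) * g j i 0 x ^ 2)
          + ∫ x, Real.exp (c * ‖x‖ ^ 2) * w j 0 x ^ 2 := by
      rw [← integral_mul_add_sum_add i0 i2 i1]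
      simp only [eψ]
    rw [hsplit, hI, mul_add, mul_add, Finset.mul_sum]
    refine add_le_add (add_le_add ?_ (Finset.sum_le_sum fun i _ => ?_)) ?_
    · simp only [hv, hu.initial]
      exact integral_exp_mul_mollify_sq_le (hρ j) (hρ0 j) (hρ1 j) (hρr j) (Lp.memLp u₀.fn) hf hc0
        hr (le_of_lt hj)
    · simp only [eg, hu.initial]
      exact integral_exp_mul_mollify_sq_le (hρ j) (hρ0 j) (hρ1 j) (hρr j) (mG u₀ i) (hG i) hc0
        hr (le_of_lt hj)
    · simp only [hw, hu.initial_deriv]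
      exact integral_exp_mul_mollify_sq_le (hρ j) (hρ0 j) (hρ1 j) (hρr j) (Lp.memLp u₁) hf₁ hc0
        hr (le_of_lt hj)
  refine integrable_and_integral_le_of_tendsto
    (F := fun j x => Real.exp (2 * psi μ δ t x) * (μ / (4 * (1 + t)) * v j t x ^ 2
        + K * (1 + t) / 4 * (w j t x ^ 2 + ∑ i, g j i t x ^ 2))) (fun j => ?_) (fun j x => ?_) ?_ ?_
  · refine Continuous.integrable_of_hasCompactSupport ?_
      (HasCompactSupport.intro (isCompact_closedBall 0 (R + 1 + t)) fun x hx => ?_)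
    · have c0 : Continuous (v j t) := continuous_slice (hcl j).cont ht
      have c1 : Continuous (w j t) := continuous_slice (hcl j).cont_w ht
      have c2 : ∀ i, Continuous (g j i t) := fun i => continuous_slice ((hcl j).cont_g i) ht
      have c3 := cexp t
      fun_prop
    · rw [Metric.mem_closedBall, dist_zero_right, not_le] at hx
      obtain ⟨h1, h2, h3⟩ := (hcl j).eq_zero_of_lt_norm hμ.le (hdata j) ht hx
      have h1' : v j t x = 0 := h1
      have h2' : w j t x = 0 := h2
      have h3' : ∀ i, g j i t x = 0 := h3
      simp [h1', h2', h3']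
  · have : 0 ≤ ∑ i, g j i t x ^ 2 := Finset.sum_nonneg fun i _ => sq_nonneg _
    positivity
  · filter_upwards [hinit] with j hj
    rw [← div_eq_inv_mul, le_div_iff₀ (by positivity), mul_comm]
    refine ((hcl j).weighted_energy_bound hp (hdata j) ht).trans ?_
    exact mul_le_mul_of_nonneg_left hj (by positivity)
  · have l0 := ae_tendsto_mollify_bump ((Lp.memLp (u t).fn).locallyIntegrable (by norm_num))
    have l1 := ae_tendsto_mollify_bump ((Lp.memLp (ut t)).locallyIntegrable (by norm_num))
    have l2 := ae_all_iff.2 fun i =>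
      ae_tendsto_mollify_bump ((mG (u t) i).locallyIntegrable (by norm_num))
    filter_upwards [l0, l1, l2] with x h0 h1 h2
    rw [norm_sq_eq_sum_inner_single]
    simp only [eg]
    exact (((h0.pow 2).const_mul _).add (((h1.pow 2).add
      (tendsto_finsetSum _ fun i _ => (h2 i).pow 2)).const_mul _)).const_mul _

/-! ### Choice of the parameters -/

/-- For large `μ` the parameters are admissible with decay exponent `k = n + 1 - ε`. -/
theorem exists_admissibleParameters {n : ℕ} (hn : 1 ≤ n) {ε : ℝ} (hε : 0 < ε) (hε1 : ε ≤ 1) :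
    ∃ δ : ℝ, 0 < δ ∧ ∃ K μ₀ : ℝ, 1 < μ₀ ∧ ∀ μ, μ₀ ≤ μ →
      AdmissibleParameters n μ δ K (n + 1 - ε) (ε / 2) := by
  have hn' : (1 : ℝ) ≤ n := by exact_mod_cast hn
  set k : ℝ := n + 1 - ε with hk
  have hk0 : 0 < 1 + k := by rw [hk]; linarith
  set δ := ε / n with hδ
  have hδ0 : 0 < δ := by positivity
  have hnδ : n * δ = ε := by rw [hδ]; field_simp
  set K := 2 * (δ / (8 + δ)) / (1 + k) with hK
  have hK0 : 0 < K := by positivity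
  have hKk : K * (1 + k) / 2 = δ / (8 + δ) := by rw [hK]; field_simp
  have hα : δ / (8 + δ) ≤ 1 := by
    rw [div_le_one (by positivity)]; linarith
  have b0 : 0 ≤ 2 / K * (2 + k ^ 2 / ε) := by positivity
  have b1 : 0 ≤ 2 * (2 + δ) / (K * δ) := by positivity
  have b2 : 0 ≤ 4 / K := by positivity
  refine ⟨δ, hδ0, K, 2 + 2 / K * (2 + k ^ 2 / ε) + 2 * (2 + δ) / (K * δ) + 4 / K, by linarith,
    fun μ hμ => ?_⟩
  have hμ1 : 1 ≤ μ := by linarith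
  have hμ0 : 0 < μ := by linarith
  refine ⟨hμ0, hδ0, hK0, by positivity, ?_, hKk.le, ?_, ?_, ?_⟩
  · have : (n : ℝ) / 2 - ε / 4 ≤ n / (2 + δ) := by
      rw [le_div_iff₀ (by positivity)]
      nlinarith
    rw [hk]
    linarith
  · have : 2 * (2 + δ) / (K * δ) ≤ μ := by linarith
    rw [div_le_iff₀ (by positivity)] at this
    linarith
  · have h1 : 2 / K * (2 + k ^ 2 / ε) ≤ μ := by linarith
    rw [div_mul_eq_mul_div, div_le_iff₀ hK0] at h1
    have h2 : k ^ 2 / (2 * (ε / 2) * μ) ≤ k ^ 2 / ε := by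
      apply div_le_div_of_nonneg_left (sq_nonneg _) hε
      nlinarith
    have h3 : 1 / (2 + δ) ≤ 1 / 2 := one_div_le_one_div_of_le two_pos (by linarith)
    have h4 : K * μ * (1 / 2) ≤ K * μ * (1 - 1 / (2 + δ)) :=
      mul_le_mul_of_nonneg_left (by linarith) (by positivity)
    rw [hKk]
    linarith
  · have : 4 / K ≤ μ := by linarith
    rw [div_le_iff₀ hK0] at this
    linarith

/-- If a sum of nonnegative functions is integrable, so is each multiple `f` of a summand, with the
corresponding bound for the integral. -/
theorem integrable_and_integral_le_of_mul_le {α : Type*} [MeasurableSpace α] {ν : Measure α}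
    {f F : α → ℝ} {c B : ℝ} (hc : 0 < c) (hf : AEStronglyMeasurable f ν) (h0 : ∀ x, 0 ≤ f x)
    (hF : Integrable F ν) (hB : ∫ x, F x ∂ν ≤ B) (h : ∀ x, c * f x ≤ F x) :
    Integrable f ν ∧ ∫ x, f x ∂ν ≤ c⁻¹ * B := by
  have hle : ∀ x, f x ≤ c⁻¹ * F x := fun x => by
    rw [← div_eq_inv_mul, le_div_iff₀ hc, mul_comm]
    exact h x
  have hi : Integrable f ν := (hF.const_mul c⁻¹).mono' hf
    (Filter.Eventually.of_forall fun x => by rw [Real.norm_of_nonneg (h0 x)]; exact hle x)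
  refine ⟨hi, (integral_mono hi (hF.const_mul c⁻¹) hle).trans ?_⟩
  rw [integral_const_mul]
  gcongr

end DampedWave

end

theorem theorem1p1 (n : ℕ) (hn : 1 ≤ n) (ε : ℝ) (hε : 0 < ε) :
    ∃ δ : ℝ, 0 < δ ∧ ∃ μ₀ : ℝ, 1 < μ₀ ∧ ∀ μ : ℝ, μ₀ ≤ μ → ∃ C : ℝ, 0 < C ∧
      ∀ (u₀ : DampedWave.H1 n) (u₁ : DampedWave.L2 n),
        DampedWave.CompactlySupported u₀.fn → DampedWave.CompactlySupported u₁ →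
        ∀ (u : ℝ → DampedWave.H1 n) (ut : ℝ → DampedWave.L2 n),
          DampedWave.IsSolution μ u₀ u₁ u ut → ∀ t : ℝ, 0 ≤ t →
            (Integrable (fun x => Real.exp (2 * DampedWave.psi μ δ t x) * (u t).fn x ^ 2) ∧
              ∫ x, Real.exp (2 * DampedWave.psi μ δ t x) * (u t).fn x ^ 2
                ≤ C * DampedWave.initialEnergy μ δ u₀ u₁ * (1 + t) ^ (-(n : ℝ) + ε)) ∧
            (Integrable (fun x => Real.exp (2 * DampedWave.psi μ δ t x) *
                (ut t x ^ 2 + ‖(u t).grad x‖ ^ 2)) ∧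
              ∫ x, Real.exp (2 * DampedWave.psi μ δ t x) * (ut t x ^ 2 + ‖(u t).grad x‖ ^ 2)
                ≤ C * DampedWave.initialEnergy μ δ u₀ u₁ * (1 + t) ^ (-(n : ℝ) - 2 + ε)) := by
  -- the decay is slower for larger `ε`, so `ε` may be replaced by `min ε 1`
  obtain ⟨δ, hδ, K, μ₀, hμ₀, hp⟩ := DampedWave.exists_admissibleParameters hn
    (lt_min hε one_pos) (min_le_right ε 1)
  refine ⟨δ, hδ, μ₀, hμ₀, fun μ hμ => ?_⟩
  have hK := (hp μ hμ).K_pos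
  have hμ0 := (hp μ hμ).μ_pos
  set k : ℝ := n + 1 - min ε 1 with hk
  refine ⟨8 * (1 + μ + K) * (1 / μ + 1 / K), by positivity, ?_⟩
  intro u₀ u₁ hu₀ hu₁ u ut hu t ht
  have hs : 0 < 1 + t := by linarith
  obtain ⟨hint, hle⟩ := hu.weighted_energy_bound (hp μ hμ) hu₀ hu₁ ht
  set I := DampedWave.initialEnergy μ δ u₀ u₁ with hI
  have hI0 : 0 ≤ I := integral_nonneg fun x => by positivity
  have cexp : Continuous fun x : DampedWave.E n => Real.exp (2 * DampedWave.psi μ δ t x) := by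
    simp only [DampedWave.psi]; fun_prop
  have m0 := (Lp.memLp (u t).fn).integrable_sq.1
  have m1 := (Lp.memLp (ut t)).integrable_sq.1
  have m2 := (Lp.memLp (u t).grad).norm.integrable_sq.1
  have hmin : min ε 1 ≤ ε := min_le_left ε 1
  constructor
  · obtain ⟨h1, h2⟩ := DampedWave.integrable_and_integral_le_of_mul_le
      (f := fun x => Real.exp (2 * DampedWave.psi μ δ t x) * (u t).fn x ^ 2)
      (c := μ / (4 * (1 + t))) (by positivity) (cexp.aestronglyMeasurable.mul m0)
      (fun x => by positivity) hint hle (fun x => by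
        rw [mul_left_comm]
        gcongr
        have : 0 ≤ K * (1 + t) / 4 * (ut t x ^ 2 + ‖(u t).grad x‖ ^ 2) := by positivity
        linarith)
    refine ⟨h1, h2.trans ?_⟩
    have e : (μ / (4 * (1 + t)))⁻¹ * (((1 + t) ^ k)⁻¹ * ((1 + μ + K) * (2 * I)))
        = 8 * (1 + μ + K) * (1 / μ) * I * (1 + t) ^ (1 - k) := by
      rw [Real.rpow_sub hs 1 k, Real.rpow_one]
      field_simp
      ring
    rw [e]
    gcongr ?_ * _ * ?_
    · have : 0 < 1 / K := by positivity
      gcongr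
      linarith
    · exact Real.rpow_le_rpow_of_exponent_le (by linarith) (by rw [hk]; linarith)
  · obtain ⟨h1, h2⟩ := DampedWave.integrable_and_integral_le_of_mul_le
      (f := fun x => Real.exp (2 * DampedWave.psi μ δ t x) * (ut t x ^ 2 + ‖(u t).grad x‖ ^ 2))
      (c := K * (1 + t) / 4) (by positivity) (cexp.aestronglyMeasurable.mul (m1.add m2))
      (fun x => by positivity) hint hle (fun x => by
        rw [mul_left_comm]
        gcongr
        have : 0 ≤ μ / (4 * (1 + t)) * (u t).fn x ^ 2 := by positivity
        linarith)
    refine ⟨h1, h2.trans ?_⟩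
    have e : (K * (1 + t) / 4)⁻¹ * (((1 + t) ^ k)⁻¹ * ((1 + μ + K) * (2 * I)))
        = 8 * (1 + μ + K) * (1 / K) * I * (1 + t) ^ (-1 - k) := by
      rw [Real.rpow_sub hs (-1) k, Real.rpow_neg_one]
      field_simp
      ring
    rw [e]
    gcongr ?_ * _ * ?_
    · have : 0 < 1 / μ := by positivity
      gcongr
      linarith
    · exact Real.rpow_le_rpow_of_exponent_le (by linarith) (by rw [hk]; linarith)
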